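/- **Setting.** A typical user equipment (UE) sits at the origin of $\mathbb R^2$. Small base stations (SBSs) form a homogeneous Poisson process $\Phi$ of density $\lambda_S>0$; the UE is served by the nearest SBS, at distance $R$. All links have independent $\mathrm{Exp}(1)$ fading power gains, transmit power $P_a>0$ and path loss $\beta r^{-\alpha}$ ($\beta>0$, $\alpha>2$); noise is neglected. Let $q\in(0,1)$ be the hit probability. The SBSs are independently thinned into those with access links (density $q\lambda_S$) and those with backhaul links (density $(1-q)\lambda_S$). Fix $Q,W>0$, $\eta,\epsilon\in(0,1)$ and $0\le T_1<T_{th}$ ($T_1$ is the backhaul delivery time, $Q$ the number of bits of a content, $W$ the bandwidth, $\eta$ the fraction of it used for cached content delivery). If the serving SBS has $k\ge1$ UEs, the access rates for cached and for self-backhauled contents are $$R_a=\tfrac{\eta W}{k}\log_2\Big(1+\tfrac{P_ah_o\beta R^{-\alpha}}{I_a}\Big),\qquad R_{a'}=\tfrac{(1-\eta)W}{k}\log_2\Big(1+\tfrac{P_ah_o\beta R^{-\alpha}}{I_{a'}}\Big),$$ where $h_o$ is the fading gain of the serving link, and $I_a$, $I_{a'}$ are the powers received from the other SBSs with access, respectively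 backhaul, links. Let $\Lambda^a(k)=\Pr(R_a\ge Q/T_{th})$ and $\Lambda^b(k)=\Pr(R_{a'}\ge Q/(T_{th}-T_1))$. With UE density $\lambda_U>0$, the load has PMF $\mathcal P_{\lambda_U/\lambda_S}$, where for $x>0$ $$\mathcal P_x(k)=\frac{\gamma^\gamma}{(k-1)!}\frac{\Gamma(k+\gamma)}{\Gamma(\gamma)}\frac{x^{k-1}}{(\gamma+x)^{k+\gamma}},\qquad k\ge1,\ \gamma=3.5 .$$ Delivery at load $k$ is successful if $\Lambda(k)\ge\epsilon$, so the successful content delivery (SCD) probability is $$\Psi=q\sum_{k\ge1,\ \Lambda^a(k)\ge\epsilon}\mathcal P_{\lambda_U/\lambda_S}(k)+(1-q)\sum_{k\ge1,\ \Lambda^b(k)\ge\epsilon}\mathcal P_{\lambda_U/\lambda_S}(k).$$ Put $G(y)=\frac{2^{y+1}-2}{\alpha-2}\,{}_2F_1\big[1,1-\tfrac2\alpha;2-\tfrac2\alpha;1-2^y\big]$, $A=\frac{Q}{\eta WT_{th}}$, $B=\frac{Q}{(1-\eta)W(T_{th}-T_1)}$, $\Xi_a=1/G(A)$, $\Xi_b=1/G(B)$.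 The maximum loads $K^a_{\max}$ and $K^b_{\max}$ are the integer parts of the solutions $\kappa\ge0$ of $G(\kappa A)=\frac{1-\epsilon}{q\epsilon}$ and of $G(\kappa B)=\frac{1-\epsilon}{(1-q)\epsilon}$; they do not depend on $\lambda_S$ or $\lambda_U$. For $\rho>0$ say that $\lambda_S$ *meets the minimum SBS density for $K$* if either $\mathcal P_{K+1}(K+1)\le\rho$ and $\lambda_S=\lambda_U/(K+1)$, or $\mathcal P_{K+1}(K+1)>\rho$ and $\lambda_S\ge\lambda_U/\mu$, where $\mu\in(0,\frac{K\gamma}{\gamma+1}]$ solves $\mathcal P_{\mu}(K+1)=\rho$. **Claim.** Let $0\le\varsigma<1$, let $a_j=j^{-\varsigma}/\sum_{m=1}^Jm^{-\varsigma}$ be the Zipf popularities of $J\ge1$ contents, and suppose that each SBS caches the $L$ most popular ones. For every $x\in[0,1]$, $\sum_{j\le\lfloor xJ\rfloor}a_j\to x^{1-\varsigma}$ as $J\to\infty$. Accordingly take $q=q(L)=(L/J)^{1-\varsigma}$, for real $L\in(0,J)$. 1. Suppose $\frac{T_{th}-T_1}{T_{th}}\le\frac{\eta}{1-\eta}$,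 and consider $0<L\in\big[J([1-\Xi_b\frac{1-\epsilon}{\epsilon}]^+)^{\frac1{1-\varsigma}},\,J(\tfrac12)^{\frac1{1-\varsigma}}\big]$. Then $K^b_{\max}\ge1$, and $\Psi\approx\sum_{k=1}^{K^b_{\max}}\mathcal P_{\lambda_U/\lambda_S}(k)$ in this sense: whenever $\rho>0$ and $\lambda_S$ meets the minimum SBS density for $K^b_{\max}$, $$0\le\Psi-\sum_{k=1}^{K^b_{\max}}\mathcal P_{\lambda_U/\lambda_S}(k)\le q\,(K^a_{\max}-K^b_{\max})\,\rho .$$ On this range of $L$, at fixed $\lambda_U$ and $\lambda_S$, the sum $\sum_{k=1}^{K^b_{\max}}\mathcal P_{\lambda_U/\lambda_S}(k)$ is a nondecreasing function of $L$. Moreover $\Psi$ is nondecreasing up to the same error: for $L_1\le L_2$ in the range, if $\lambda_S$ meets the minimum SBS density for $K^b_{\max}(L_1)$, then $\Psi(L_1)\le\Psi(L_2)+q(L_1)\,(K^a_{\max}(L_1)-K^b_{\max}(L_1))\,\rho$. 2. Suppose $\frac{T_{th}-T_1}{T_{th}}>\frac{\eta}{1-\eta}$, and consider $J>L\in\big[J(\tfrac12)^{\frac1{1-\varsigma}},\,J(\min\{\Xi_a\frac{1-\epsilon}{\epsilon},1\})^{\frac1{1-\varsigma}}\big]$.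 Then $K^a_{\max}\ge1$, and $\Psi\approx\sum_{k=1}^{K^a_{\max}}\mathcal P_{\lambda_U/\lambda_S}(k)$: whenever $\rho>0$ and $\lambda_S$ meets the minimum SBS density for $K^a_{\max}$, $$0\le\Psi-\sum_{k=1}^{K^a_{\max}}\mathcal P_{\lambda_U/\lambda_S}(k)\le(1-q)\,(K^b_{\max}-K^a_{\max})\,\rho .$$ -/

import Mathlib

open MeasureTheory ProbabilityTheory Filter Topology Set
open scoped ENNReal NNReal

noncomputable section

namespace EdgeCaching

/-! ### Special functions -/

/-- The Gauss hypergeometric function `₂F₁[a, b; c; z]` for `0 < b < c` and real `z < 1`, given by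
its Euler integral. (The arguments needed below are `z = 1 - 2 ^ y` with `y > 0`, which may lie
outside the disc of convergence of the hypergeometric series.) -/
def gaussHypergeometric (a b c z : ℝ) : ℝ :=
  Real.Gamma c / (Real.Gamma b * Real.Gamma (c - b)) *
    ∫ t in (0 : ℝ)..1, t ^ (b - 1) * (1 - t) ^ (c - b - 1) * (1 - z * t) ^ (-a)

/-- `(2 ^ (y + 1) - 2) / (α - 2) * ₂F₁[1, 1 - 2/α; 2 - 2/α; 1 - 2 ^ y]`. -/
def loadFactor (α y : ℝ) : ℝ :=
  ((2 : ℝ) ^ (y + 1) - 2) / (α - 2) *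
    gaussHypergeometric 1 (1 - 2 / α) (2 - 2 / α) (1 - (2 : ℝ) ^ y)

/-! ### System parameters -/

/-- The deterministic parameters of the access links. -/
structure SystemParams where
  /-- number of bits of a content -/
  Q : ℝ
  /-- delivery time threshold -/
  Tth : ℝ
  /-- time for delivering a non-cached content to the SBS via wireless backhaul -/
  T1 : ℝ
  /-- fraction of the bandwidth allocated to cached content delivery -/
  η : ℝ
  /-- system bandwidth -/
  W : ℝ
  /-- transmit power of an SBS -/
  Pa : ℝ
  /-- frequency dependent constant of the path loss -/
  β : ℝ
  /-- path loss exponent of the access links -/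
  α : ℝ
  /-- threshold for successful content delivery -/
  ε : ℝ

/-- The admissible range of the parameters. -/
structure SystemParams.Valid (s : SystemParams) : Prop where
  Q_pos : 0 < s.Q
  T1_nonneg : 0 ≤ s.T1
  T1_lt : s.T1 < s.Tth
  η_pos : 0 < s.η
  η_lt : s.η < 1
  W_pos : 0 < s.W
  Pa_pos : 0 < s.Pa
  β_pos : 0 < s.β
  α_gt : 2 < s.α
  ε_pos : 0 < s.ε
  ε_lt : s.ε < 1

/-! ### The stochastic network -/

/-- `N` is a Poisson point process (Poisson random measure) with intensity measure `μ`: the number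
of points in a measurable set `B` with `μ B < ∞` is Poisson with mean `μ B`, and the numbers of
points in pairwise disjoint measurable sets are independent. -/
structure IsPoissonProcess {Ω X : Type*} [MeasurableSpace Ω] [MeasurableSpace X]
    (P : Measure Ω) (N : Ω → Measure X) (μ : Measure X) : Prop where
  measurable : Measurable N
  law : ∀ B : Set X, MeasurableSet B → μ B ≠ ∞ →
    P.map (fun ω => N ω B) =
      (poissonMeasure (μ B).toNNReal).map (fun n : ℕ => (n : ℝ≥0∞))
  indep : ∀ (n : ℕ) (B : Fin n → Set X), (∀ i, MeasurableSet (B i)) →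
    Pairwise (fun i j => Disjoint (B i) (B j)) →
    iIndepFun (fun i ω => N ω (B i)) P

/-- The plane. -/
abbrev Plane : Type := EuclideanSpace ℝ (Fin 2)

/-- An SBS with its position, its type mark and its fading mark. -/
abbrev MarkedSBS : Type := Plane × ℝ × ℝ

/-- Intensity of the marked SBS process: Lebesgue measure of density `lamS` for the positions,
independent uniform type marks on `[0, 1]`, and independent `Exp(1)` (Rayleigh) fading power
gains. -/
def sbsIntensity (lamS : ℝ) : Measure MarkedSBS :=
  ENNReal.ofReal lamS •
    ((volume : Measure Plane).prod
      (((volume : Measure ℝ).restrict (Icc 0 1)).prod (expMeasure 1)))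

/-- The network seen from a typical UE at the origin: `Φ` is the homogeneous Poisson point process
of (marked) SBSs with density `lamS`, and `h` is the `Exp(1)` fading power gain of the link between
the typical UE and its own SBS, independent of `Φ`. -/
structure IsSBSNetwork {Ω : Type*} [MeasurableSpace Ω] (P : Measure Ω) (lamS : ℝ)
    (Φ : Ω → Measure MarkedSBS) (h : Ω → ℝ) : Prop where
  poisson : IsPoissonProcess P Φ (sbsIntensity lamS)
  h_measurable : Measurable h
  h_law : P.map h = expMeasure 1
  indep : IndepFun h Φ P

/-- Distance from the origin to the nearest point of the configuration `N`. With equal transmit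
powers this is the SBS of maximum average received power, i.e. the serving SBS. -/
def nearestDist (N : Measure MarkedSBS) : ℝ :=
  sInf {r : ℝ | 0 ≤ r ∧ 0 < N (Metric.closedBall (0 : Plane) r ×ˢ univ)}

/-- Path loss at distance `r`. -/
def pathLoss (s : SystemParams) (r : ℝ) : ℝ := s.β * r ^ (-s.α)

/-- Total power received at the origin from the SBSs of `N` other than the serving one whose type
mark lies in `T`. -/
def interference (s : SystemParams) (T : Set ℝ) (N : Measure MarkedSBS) : ℝ :=
  (∫⁻ p in {p : MarkedSBS | nearestDist N < ‖p.1‖ ∧ p.2.1 ∈ T},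
    ENNReal.ofReal (s.Pa * p.2.2 * pathLoss s ‖p.1‖) ∂N).toReal

/-- Rate of the typical access link in the interference-limited network, when the bandwidth `bw` is
shared by `k` UEs and the interferers are the other SBSs with type mark in `T`. -/
def accessRate (s : SystemParams) (bw : ℝ) (T : Set ℝ) (k : ℕ) (N : Measure MarkedSBS)
    (h : ℝ) : ℝ :=
  bw / k * Real.logb 2 (1 + s.Pa * h * pathLoss s (nearestDist N) / interference s T N)

/-- Conditional probability, given load `k`, that a cached content is delivered within `Tth`. The
SBSs with access links are those with type mark at most `q`, a thinning of density `q * lamS`. -/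
def successA {Ω : Type*} [MeasurableSpace Ω] (P : Measure Ω) (s : SystemParams)
    (Φ : Ω → Measure MarkedSBS) (h : Ω → ℝ) (q : ℝ) (k : ℕ) : ℝ :=
  P.real {ω | s.Q / s.Tth ≤ accessRate s (s.η * s.W) (Iic q) k (Φ ω) (h ω)}

/-- Conditional probability, given load `k`, that a content obtained via backhaul is delivered over
the access link within the remaining time `Tth - T1`. The SBSs with backhaul links are those with
type mark above `q`, a thinning of density `(1 - q) * lamS`. -/
def successB {Ω : Type*} [MeasurableSpace Ω] (P : Measure Ω) (s : SystemParams)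
    (Φ : Ω → Measure MarkedSBS) (h : Ω → ℝ) (q : ℝ) (k : ℕ) : ℝ :=
  P.real {ω | s.Q / (s.Tth - s.T1) ≤
    accessRate s ((1 - s.η) * s.W) (Ioi q) k (Φ ω) (h ω)}

/-! ### Load and successful content delivery -/

/-- The constant `γ = 3.5`. -/
def gam : ℝ := 7 / 2

/-- Probability that `k - 1` other UEs are served by the typical SBS (`k ≥ 1`), for the ratio `x` of
UE density to SBS density. -/
def loadPMF (x : ℝ) (k : ℕ) : ℝ :=
  gam ^ gam / ((k - 1).factorial : ℝ) * (Real.Gamma (k + gam) / Real.Gamma gam) *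
    (x ^ (k - 1) / (gam + x) ^ ((k : ℝ) + gam))

/-- `∑_{k=1}^K` of the load PMF. -/
def loadCDF (x : ℝ) (K : ℕ) : ℝ := ∑ k ∈ Finset.Icc 1 K, loadPMF x k

open Classical in
/-- Probability that the load `k ≥ 1` is such that delivery succeeds, i.e. such that the conditional
success probability `succ k` is at least `ε`. -/
def scdOf (ε x : ℝ) (succ : ℕ → ℝ) : ℝ :=
  ∑' k : ℕ, if 1 ≤ k ∧ ε ≤ succ k then loadPMF x k else 0

/-- SCD probability of a typical UE with hit probability `q`. -/
def scdProb {Ω : Type*} [MeasurableSpace Ω] (P : Measure Ω) (s : SystemParams)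
    (Φ : Ω → Measure MarkedSBS) (h : Ω → ℝ) (lamU lamS q : ℝ) : ℝ :=
  q * scdOf s.ε (lamU / lamS) (successA P s Φ h q) +
    (1 - q) * scdOf s.ε (lamU / lamS) (successB P s Φ h q)

/-- Spectral efficiency per UE needed for cached delivery. -/
def effA (s : SystemParams) : ℝ := s.Q / (s.η * s.W * s.Tth)

/-- Spectral efficiency per UE needed for self-backhauled delivery. -/
def effB (s : SystemParams) : ℝ := s.Q / ((1 - s.η) * s.W * (s.Tth - s.T1))

/-- The integer part of the (unique) solution `κ ≥ 0` of `loadFactor α (κ * A) = c`. -/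
def maxLoad (α A c : ℝ) : ℕ := ⌊sSup {κ : ℝ | 0 ≤ κ ∧ loadFactor α (κ * A) = c}⌋₊

/-- Maximum load for cached delivery at hit probability `q`. -/
def maxLoadA (s : SystemParams) (q : ℝ) : ℕ :=
  maxLoad s.α (effA s) ((1 - s.ε) / (q * s.ε))

/-- Maximum load for self-backhauled delivery at hit probability `q`. -/
def maxLoadB (s : SystemParams) (q : ℝ) : ℕ :=
  maxLoad s.α (effB s) ((1 - s.ε) / ((1 - q) * s.ε))

/-- The constant `Ξ_a`. -/
def XiA (s : SystemParams) : ℝ := (loadFactor s.α (effA s))⁻¹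

/-- The constant `Ξ_b`. -/
def XiB (s : SystemParams) : ℝ := (loadFactor s.α (effB s))⁻¹

/-- `lamS` meets the minimum SBS density requirement for maximum load `K` and overload level `ρ`.
If the load PMF with density ratio `K + 1` is at most `ρ` at `K + 1`, the prescribed density is
`lamU / (K + 1)`; otherwise any density from `lamU / μ` on is allowed, where `μ` is the solution in
`(0, K γ / (γ + 1)]` of `loadPMF μ (K + 1) = ρ`. -/
def MeetsSBSDensity (lamU lamS : ℝ) (K : ℕ) (ρ : ℝ) : Prop :=
  (loadPMF ((K : ℝ) + 1) (K + 1) ≤ ρ ∧ lamS = lamU / ((K : ℝ) + 1)) ∨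
  (ρ < loadPMF ((K : ℝ) + 1) (K + 1) ∧
    ∃ μ ∈ Ioc (0 : ℝ) (K * gam / (gam + 1)), loadPMF μ (K + 1) = ρ ∧ lamU / μ ≤ lamS)

/-! ### Caching -/

/-- Zipf request probability of the `j`-th most popular of `J` contents. -/
def zipf (ς : ℝ) (J j : ℕ) : ℝ :=
  (j : ℝ) ^ (-ς) / ∑ m ∈ Finset.Icc 1 J, (m : ℝ) ^ (-ς)

/-- Hit probability when the `L` most popular of `J` contents are cached. -/
def mpcHitProb (ς : ℝ) (J L : ℕ) : ℝ := ∑ j ∈ Finset.Icc 1 L, zipf ς J j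

/-- The approximate hit probability `(L / J) ^ (1 - ς)`, as a function of a real cache size. -/
def hitProb (ς : ℝ) (J : ℕ) (L : ℝ) : ℝ := (L / J) ^ (1 - ς)

/-- Cache sizes `L > 0` between `J ([1 - Ξ_b (1-ε)/ε]⁺)^(1/(1-ς))` and `J (1/2)^(1/(1-ς))`. -/
def cacheRangeB (s : SystemParams) (ς : ℝ) (J : ℕ) : Set ℝ :=
  {L | 0 < L ∧
    L ∈ Icc (J * (max (1 - XiB s * ((1 - s.ε) / s.ε)) 0) ^ (1 / (1 - ς)))
      (J * (1 / 2 : ℝ) ^ (1 / (1 - ς)))}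

/-- Cache sizes `L < J` between `J (1/2)^(1/(1-ς))` and `J (min {Ξ_a (1-ε)/ε, 1})^(1/(1-ς))`. -/
def cacheRangeA (s : SystemParams) (ς : ℝ) (J : ℕ) : Set ℝ :=
  {L | L < J ∧
    L ∈ Icc (J * (1 / 2 : ℝ) ^ (1 / (1 - ς)))
      (J * (min (XiA s * ((1 - s.ε) / s.ε)) 1) ^ (1 / (1 - ς)))}

end EdgeCaching

end

/-! Everything reduces to one identity. If `F` is the distribution function of the load, then `Ψ = q
F(K_a) + (1 - q) F(K_b)` (`IsSBSNetwork.scdProb_eq`). When `K_b ≤ K_a`, the excess of `Ψ` over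
`F(K_b)` is `q` times the sum of the load PMF over `K_b < k ≤ K_a`, and the density requirement
bounds every term by `ρ`: the PMF decreases in `k` once `k` is at least the density ratio
(`loadPMF_succ_le`), and its value at `K + 1` increases with the ratio up to `K γ / (γ + 1)`
(`loadPMF_mono_left`). The order of the two maximum loads follows from comparing the required
spectral efficiencies and the interferer densities `q λ` and `(1 - q) λ`.

The identity rests on the coverage probability. Delivery at load `k` succeeds iff the `Exp(1)` gain
exceeds `θ R ^ α` times the shot noise of the interferers, where `θ = 2 ^ (k A) - 1` (with `B` in
place of `A` for self-backhauled contents). So the success probability is the mean of `exp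
(-threshold)`, and it equals `1 / (1 + p G(k A))` with `p` the retained fraction of the thinning
(`integral_expNeg_thresholdGain`). It is at least `ε` iff `G(k A) ≤ (1 - ε) / (p ε)`, that is, iff
`k` is at most the maximum load.

The textbook route to the mean conditions on `R = r`. Here the conditioning is replaced by a
discretization: `R` is localized in annuli `(δ ^ i, δ ^ (i + 1)]`, the threshold is compared there
with a functional of the points outside the annulus, and the Laplace functional
(`IsPoissonProcess.laplace`) evaluates that functional jointly with the void events. Summing over
`i` and letting `δ → 1` gives the exact value. The Laplace functional is stated for `[0, ∞]`-valued
functions, so that `expNeg (∞ * N B)` is the indicator of `N B = 0`. -/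

noncomputable section

namespace EdgeCaching

/-! ### The function `exp (-x)` on `[0, ∞]` -/

/-- `exp (-x)` for `x ∈ [0, ∞]`, with value `0` at `∞`. -/
def expNeg (x : ℝ≥0∞) : ℝ := (EReal.exp (-(x : EReal))).toReal

@[simp] lemma expNeg_top : expNeg ∞ = 0 := by simp [expNeg]

@[simp] lemma expNeg_zero : expNeg 0 = 1 := by simp [expNeg]

lemma expNeg_of_ne_top {x : ℝ≥0∞} (hx : x ≠ ∞) : expNeg x = Real.exp (-x.toReal) := by
  lift x to ℝ≥0 using hx
  have : (-((x : ℝ≥0∞) : EReal)) = ((-(x : ℝ) : ℝ) : EReal) := rfl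
  rw [expNeg, this, EReal.exp_coe, ENNReal.toReal_ofReal (Real.exp_pos _).le]
  rfl

lemma expNeg_ofReal {r : ℝ} (hr : 0 ≤ r) : expNeg (ENNReal.ofReal r) = Real.exp (-r) := by
  rw [expNeg_of_ne_top ENNReal.ofReal_ne_top, ENNReal.toReal_ofReal hr]

lemma expNeg_nonneg (x : ℝ≥0∞) : 0 ≤ expNeg x := ENNReal.toReal_nonneg

lemma expNeg_le_one (x : ℝ≥0∞) : expNeg x ≤ 1 := by
  rcases eq_or_ne x ∞ with rfl | hx
  · simp
  · rw [expNeg_of_ne_top hx]; simp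

lemma continuous_expNeg : Continuous expNeg := by
  have h : ∀ x : ℝ≥0∞, EReal.exp (-(x : EReal)) ≠ ∞ := fun x => by
    rw [Ne, EReal.exp_eq_top_iff]
    simp
  refine continuous_iff_continuousAt.2 fun x => ?_
  have h1 : Continuous fun x : ℝ≥0∞ => EReal.exp (-(x : EReal)) :=
    ENNReal.continuous_exp.comp (continuous_neg.comp continuous_coe_ennreal_ereal)
  exact (ENNReal.tendsto_toReal (h x)).comp h1.continuousAt

lemma measurable_expNeg : Measurable expNeg := continuous_expNeg.measurable

lemma expNeg_add (x y : ℝ≥0∞) : expNeg (x + y) = expNeg x * expNeg y := by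
  rcases eq_or_ne x ∞ with rfl | hx
  · simp
  rcases eq_or_ne y ∞ with rfl | hy
  · simp
  rw [expNeg_of_ne_top hx, expNeg_of_ne_top hy, expNeg_of_ne_top (by simp [hx, hy]),
    ENNReal.toReal_add hx hy, neg_add, Real.exp_add]

lemma expNeg_antitone : Antitone expNeg := fun x y hxy => by
  obtain ⟨z, rfl⟩ := exists_add_of_le hxy
  rw [expNeg_add]
  exact mul_le_of_le_one_right (expNeg_nonneg _) (expNeg_le_one _)

lemma expNeg_sum {ι : Type*} (s : Finset ι) (f : ι → ℝ≥0∞) :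
    expNeg (∑ i ∈ s, f i) = ∏ i ∈ s, expNeg (f i) := by
  classical
  induction s using Finset.induction_on with
  | empty => simp
  | insert a s ha ih => rw [Finset.sum_insert ha, Finset.prod_insert ha, expNeg_add, ih]

lemma expNeg_mul_natCast (c : ℝ≥0∞) (n : ℕ) : expNeg (c * n) = expNeg c ^ n := by
  induction n with
  | zero => simp
  | succ n ih => rw [Nat.cast_succ, mul_add, mul_one, expNeg_add, ih, pow_succ]

/-- `1 - exp (-x)`, as an extended nonnegative real. -/
def oneSubExpNeg (x : ℝ≥0∞) : ℝ≥0∞ := ENNReal.ofReal (1 - expNeg x)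

@[simp] lemma oneSubExpNeg_zero : oneSubExpNeg 0 = 0 := by simp [oneSubExpNeg]

@[simp] lemma oneSubExpNeg_top : oneSubExpNeg ∞ = 1 := by simp [oneSubExpNeg]

lemma oneSubExpNeg_ne_top (x : ℝ≥0∞) : oneSubExpNeg x ≠ ∞ := ENNReal.ofReal_ne_top

lemma continuous_oneSubExpNeg : Continuous oneSubExpNeg :=
  ENNReal.continuous_ofReal.comp (continuous_const.sub continuous_expNeg)

lemma monotone_oneSubExpNeg : Monotone oneSubExpNeg := fun _ _ h =>
  ENNReal.ofReal_le_ofReal (sub_le_sub_left (expNeg_antitone h) _)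

/-! ### Laplace functional of a Poisson process -/

lemma integral_poissonMeasure_pow (m : ℝ≥0) (x : ℝ) :
    ∫ n, x ^ n ∂(poissonMeasure m) = Real.exp (-(m * (1 - x))) := by
  rw [integral_poissonMeasure]
  have h := (NormedSpace.expSeries_div_hasSum_exp ((m : ℝ) * x)).mul_left (Real.exp (-m))
  rw [← Real.exp_eq_exp_ℝ, ← Real.exp_add] at h
  have e : -((m : ℝ) * (1 - x)) = -m + m * x := by ring
  rw [e, ← h.tsum_eq]
  congr 1
  ext n
  rw [mul_pow, smul_eq_mul]
  ring

section Laplace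

variable {Ω X : Type*} [MeasurableSpace Ω] [MeasurableSpace X] {P : Measure Ω}
  {N : Ω → Measure X} {μ : Measure X}

lemma IsPoissonProcess.measurable_apply (hN : IsPoissonProcess P N μ) {B : Set X}
    (hB : MeasurableSet B) : Measurable fun ω => N ω B :=
  (Measure.measurable_coe hB).comp hN.measurable

lemma IsPoissonProcess.measurable_lintegral (hN : IsPoissonProcess P N μ) {f : X → ℝ≥0∞}
    (hf : Measurable f) : Measurable fun ω => ∫⁻ x, f x ∂(N ω) :=
  (Measure.measurable_lintegral hf).comp hN.measurable

/-- This is the generating function of the Poisson law at `exp (-c)`; `c = ∞` is allowed and gives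
the void probability. -/
lemma IsPoissonProcess.laplace_const (hN : IsPoissonProcess P N μ) {B : Set X}
    (hB : MeasurableSet B) (hμ : μ B ≠ ∞) (c : ℝ≥0∞) :
    ∫ ω, expNeg (c * N ω B) ∂P = expNeg (oneSubExpNeg c * μ B) := by
  have hm : Measurable fun x : ℝ≥0∞ => expNeg (c * x) :=
    measurable_expNeg.comp (measurable_const.mul measurable_id)
  have h1 : ∫ ω, expNeg (c * N ω B) ∂P = ∫ x, expNeg (c * x) ∂(P.map fun ω => N ω B) :=
    (integral_map (hN.measurable_apply hB).aemeasurable hm.aestronglyMeasurable).symm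
  rw [h1, hN.law B hB hμ, integral_map (by fun_prop) hm.aestronglyMeasurable]
  simp_rw [expNeg_mul_natCast]
  rw [integral_poissonMeasure_pow, expNeg_of_ne_top (ENNReal.mul_ne_top (oneSubExpNeg_ne_top c) hμ),
    ENNReal.toReal_mul, oneSubExpNeg, ENNReal.toReal_ofReal (sub_nonneg.2 (expNeg_le_one c)),
    mul_comm]
  rfl

/-- Independence over disjoint sets factorizes the expectation. Finiteness is required only where `c
i ≠ 0`, because the zero level set of a simple function may have infinite measure; with `c i = 0`
both factors are `1`. -/
lemma IsPoissonProcess.laplace_fin (hN : IsPoissonProcess P N μ) {n : ℕ} {B : Fin n → Set X}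
    (hB : ∀ i, MeasurableSet (B i)) (hd : Pairwise fun i j => Disjoint (B i) (B j))
    (c : Fin n → ℝ≥0∞) (hc : ∀ i, c i ≠ 0 → μ (B i) ≠ ∞) :
    ∫ ω, expNeg (∑ i, c i * N ω (B i)) ∂P = expNeg (∑ i, oneSubExpNeg (c i) * μ (B i)) := by
  have hm : ∀ i, Measurable fun x : ℝ≥0∞ => expNeg (c i * x) := fun i =>
    measurable_expNeg.comp (measurable_const.mul measurable_id)
  have hind := (hN.indep n B hB hd).comp (fun i x => expNeg (c i * x)) hm
  have := hind.isProbabilityMeasure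
  simp_rw [expNeg_sum]
  have h := hind.integral_fun_prod_eq_prod_integral
    (fun i => ((hm i).comp (hN.measurable_apply (hB i))).aestronglyMeasurable)
  simp only [Function.comp] at h
  rw [h]
  refine Finset.prod_congr rfl fun i _ => ?_
  by_cases hi : c i = 0
  · simp [hi]
  · exact hN.laplace_const (hB i) (hc i hi) (c i)

lemma IsPoissonProcess.laplace_simpleFunc (hN : IsPoissonProcess P N μ) (f : SimpleFunc X ℝ≥0∞)
    (hf : ∀ c, c ≠ 0 → μ (f ⁻¹' {c}) ≠ ∞) :
    ∫ ω, expNeg (∫⁻ x, f x ∂(N ω)) ∂P = expNeg (∫⁻ x, oneSubExpNeg (f x) ∂μ) := by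
  classical
  have e := (Fintype.equivFin f.range).symm
  have h := hN.laplace_fin (B := fun i => f ⁻¹' {(e i : ℝ≥0∞)}) (fun i => f.measurableSet_fiber _)
    (fun i j hij => Disjoint.preimage _ (by
      rw [Set.disjoint_singleton]
      exact fun h => hij (e.injective (Subtype.ext h)))) (fun i => (e i : ℝ≥0∞))
    (fun i hi => hf _ hi)
  have h1 : ∀ ν : Measure X, ∀ g : ℝ≥0∞ → ℝ≥0∞,
      ∑ i, g (e i) * ν (f ⁻¹' {(e i : ℝ≥0∞)}) = ∫⁻ x, g (f x) ∂ν := by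
    intro ν g
    rw [e.sum_comp (fun y : f.range => g y * ν (f ⁻¹' {(y : ℝ≥0∞)})),
      Finset.sum_coe_sort f.range (fun y => g y * ν (f ⁻¹' {y})), ← SimpleFunc.map_lintegral,
      ← SimpleFunc.lintegral_eq_lintegral]
    rfl
  rw [h1 μ oneSubExpNeg] at h
  rw [← h]
  congr 1
  ext ω
  rw [← h1 (N ω) (fun x => x)]

/-- The Laplace functional of a Poisson process. -/
theorem IsPoissonProcess.laplace [IsProbabilityMeasure P] [SigmaFinite μ]
    (hN : IsPoissonProcess P N μ) {f : X → ℝ≥0∞} (hf : Measurable f) :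
    ∫ ω, expNeg (∫⁻ x, f x ∂(N ω)) ∂P = expNeg (∫⁻ x, oneSubExpNeg (f x) ∂μ) := by
  -- Cutting off outside the spanning sets gives the nonzero level sets finite measure and keeps the
  -- approximation increasing.
  let g : ℕ → SimpleFunc X ℝ≥0∞ := fun n =>
    (SimpleFunc.eapprox f n).restrict (spanningSets μ n)
  have hS : ∀ n, MeasurableSet (spanningSets μ n) := measurableSet_spanningSets μ
  have hg : ∀ n x, g n x = (spanningSets μ n).indicator (SimpleFunc.eapprox f n) x := fun n x =>
    SimpleFunc.restrict_apply _ (hS n) x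
  have hgf : ∀ n c, c ≠ 0 → μ (g n ⁻¹' {c}) ≠ ∞ := by
    intro n c hc
    refine ((measure_mono ?_).trans_lt (measure_spanningSets_lt_top μ n)).ne
    intro x hx
    by_contra hxn
    have : g n x = c := hx
    rw [hg, indicator_of_notMem hxn] at this
    exact hc this.symm
  have hmono : ∀ x, Monotone fun n => g n x := by
    intro x m n hmn
    simp only [hg]
    refine (indicator_le_indicator (SimpleFunc.monotone_eapprox f hmn x)).trans ?_
    exact indicator_le_indicator_of_subset (monotone_spanningSets μ hmn) (fun _ => zero_le) x
  have hlim : ∀ x, Tendsto (fun n => g n x) atTop (𝓝 (f x)) := by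
    intro x
    have h1 : Tendsto (fun n => SimpleFunc.eapprox f n x) atTop (𝓝 (f x)) := by
      rw [← SimpleFunc.iSup_eapprox_apply hf x]
      exact tendsto_atTop_iSup fun m n hmn => SimpleFunc.monotone_eapprox f hmn x
    refine h1.congr' ?_
    filter_upwards [eventually_ge_atTop (spanningSetsIndex μ x)] with n hn
    rw [hg, indicator_of_mem]
    exact monotone_spanningSets μ hn (mem_spanningSetsIndex μ x)
  have hL : Tendsto (fun n => ∫ ω, expNeg (∫⁻ x, g n x ∂(N ω)) ∂P) atTop
      (𝓝 (∫ ω, expNeg (∫⁻ x, f x ∂(N ω)) ∂P)) := by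
    refine tendsto_integral_of_dominated_convergence (fun _ => 1) (fun n => ?_)
      (integrable_const _) (fun n => ?_) ?_
    · exact (measurable_expNeg.comp
        (hN.measurable_lintegral (g n).measurable)).aestronglyMeasurable
    · filter_upwards with ω
      rw [Real.norm_of_nonneg (expNeg_nonneg _)]
      exact expNeg_le_one _
    · filter_upwards with ω
      refine (continuous_expNeg.tendsto _).comp ?_
      exact lintegral_tendsto_of_tendsto_of_monotone (fun n => (g n).measurable.aemeasurable)
        (ae_of_all _ hmono) (ae_of_all _ hlim)
  have hR : Tendsto (fun n => expNeg (∫⁻ x, oneSubExpNeg (g n x) ∂μ)) atTop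
      (𝓝 (expNeg (∫⁻ x, oneSubExpNeg (f x) ∂μ))) := by
    refine (continuous_expNeg.tendsto _).comp ?_
    refine lintegral_tendsto_of_tendsto_of_monotone
      (fun n => (continuous_oneSubExpNeg.measurable.comp (g n).measurable).aemeasurable)
      (ae_of_all _ fun x m n hmn => monotone_oneSubExpNeg (hmono x hmn))
      (ae_of_all _ fun x => (continuous_oneSubExpNeg.tendsto _).comp (hlim x))
  refine tendsto_nhds_unique hL (hR.congr fun n => ?_)
  exact (hN.laplace_simpleFunc (g n) (hgf n)).symm

end Laplace

/-! ### The load factor as a function of the SIR threshold -/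

/-- `2 / α * ∫₀¹ t ^ (-2 / α) * θ / (1 + θ t) dt`, the load factor at SIR threshold `θ`. -/
def sirFactor (α θ : ℝ) : ℝ :=
  2 / α * ∫ t in (0 : ℝ)..1, t ^ (-(2 / α)) * (θ / (1 + θ * t))

/-- Here `c - b = 1`, so the factor `(1 - t) ^ (c - b - 1)` disappears and the Gamma quotient is `1
- 2 / α`. Together with `2 θ / (α - 2)` this leaves the prefactor `2 θ / α`. -/
lemma loadFactor_eq_sirFactor {α : ℝ} (hα : 2 < α) {y : ℝ} (hy : 0 ≤ y) :
    loadFactor α y = sirFactor α ((2 : ℝ) ^ y - 1) := by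
  have h2 : (1 : ℝ) ≤ 2 ^ y := Real.one_le_rpow (by norm_num) hy
  set θ := (2 : ℝ) ^ y - 1 with hθ
  have hθ0 : 0 ≤ θ := by linarith
  have hb : 0 < 1 - 2 / α := by
    rw [sub_pos, div_lt_one (by linarith)]; exact hα
  have hG : Real.Gamma (2 - 2 / α) = (1 - 2 / α) * Real.Gamma (1 - 2 / α) := by
    rw [← Real.Gamma_add_one hb.ne']; congr 1; ring
  have hi : (∫ t in (0 : ℝ)..1, t ^ ((1 - 2 / α) - 1) * (1 - t) ^ ((2 - 2 / α) - (1 - 2 / α) - 1) *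
      (1 - (1 - (2 : ℝ) ^ y) * t) ^ (-(1 : ℝ))) =
      ∫ t in (0 : ℝ)..1, t ^ (-(2 / α)) * (1 / (1 + θ * t)) := by
    refine intervalIntegral.integral_congr fun t ht => ?_
    have e1 : (1 - 2 / α) - 1 = -(2 / α) := by ring
    have e2 : (2 - 2 / α) - (1 - 2 / α) - 1 = 0 := by ring
    have e3 : 1 - (1 - (2 : ℝ) ^ y) * t = 1 + θ * t := by rw [hθ]; ring
    simp only [e1, e2, e3, Real.rpow_zero, mul_one, Real.rpow_neg_one, one_div]
  have hs : sirFactor α θ = 2 / α * (θ * ∫ t in (0 : ℝ)..1, t ^ (-(2 / α)) * (1 / (1 + θ * t))) := by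
    rw [sirFactor, ← intervalIntegral.integral_const_mul θ]
    refine congrArg (2 / α * ·) (intervalIntegral.integral_congr fun t _ => ?_)
    ring
  have h21 : (2 : ℝ) ^ (y + 1) - 2 = 2 * θ := by
    rw [Real.rpow_add_one (by norm_num), hθ]; ring
  have hGb : Real.Gamma (1 - 2 / α) ≠ 0 := (Real.Gamma_pos_of_pos hb).ne'
  have e4 : (2 - 2 / α) - (1 - 2 / α) = 1 := by ring
  rw [loadFactor, gaussHypergeometric, hi, hs, h21, hG, e4, Real.Gamma_one]
  have hα0 : α ≠ 0 := by linarith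
  have hα2 : α - 2 ≠ 0 := by linarith
  generalize (∫ t in (0 : ℝ)..1, t ^ (-(2 / α)) * (1 / (1 + θ * t))) = I
  generalize Real.Gamma (1 - 2 / α) = g at hGb ⊢
  field_simp

lemma neg_one_lt_neg_two_div {α : ℝ} (hα : 2 < α) : -1 < -(2 / α) := by
  rw [neg_lt_neg_iff, div_lt_one (by linarith)]; exact hα

lemma intervalIntegrable_sirFactor {α : ℝ} (hα : 2 < α) {θ : ℝ} (hθ : 0 ≤ θ) :
    IntervalIntegrable (fun t : ℝ => t ^ (-(2 / α)) * (θ / (1 + θ * t))) volume 0 1 := by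
  refine (intervalIntegral.intervalIntegrable_rpow' (neg_one_lt_neg_two_div hα)).mul_continuousOn ?_
  refine continuousOn_const.div (by fun_prop) fun t ht => ?_
  rw [uIcc_of_le zero_le_one] at ht
  have := mul_nonneg hθ ht.1
  linarith

lemma sirFactor_zero (α : ℝ) : sirFactor α 0 = 0 := by simp [sirFactor]

/-- For `t ≥ 0` the map `θ ↦ θ / (1 + θ t)` has slope at most `1`. The resulting Lipschitz bound
yields continuity without differentiating under the integral. -/
lemma sirFactor_sub_le {α : ℝ} (hα : 2 < α) {θ θ' : ℝ} (hθ : 0 ≤ θ) (h : θ ≤ θ') :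
    sirFactor α θ' - sirFactor α θ ≤
      (2 / α * ∫ t in (0 : ℝ)..1, t ^ (-(2 / α))) * (θ' - θ) := by
  have hα0 : 0 < 2 / α := by have : 0 < α := by linarith
                             positivity
  rw [sirFactor, sirFactor, ← mul_sub, mul_assoc, ← intervalIntegral.integral_sub
    (intervalIntegrable_sirFactor hα (hθ.trans h)) (intervalIntegrable_sirFactor hα hθ),
    ← intervalIntegral.integral_mul_const]
  refine mul_le_mul_of_nonneg_left ?_ hα0.le
  refine intervalIntegral.integral_mono_on zero_le_one
    ((intervalIntegrable_sirFactor hα (hθ.trans h)).sub (intervalIntegrable_sirFactor hα hθ))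
    ((intervalIntegral.intervalIntegrable_rpow' (neg_one_lt_neg_two_div hα)).mul_const _) ?_
  intro t ht
  rw [← mul_sub]
  refine mul_le_mul_of_nonneg_left ?_ (Real.rpow_nonneg ht.1 _)
  have h1 := mul_nonneg hθ ht.1
  have h2 := mul_nonneg (hθ.trans h) ht.1
  rw [div_sub_div _ _ (by linarith) (by linarith), div_le_iff₀ (by positivity)]
  have : θ' * (1 + θ * t) - (1 + θ' * t) * θ = θ' - θ := by ring
  rw [this]
  refine le_mul_of_one_le_right (by linarith) ?_
  nlinarith [mul_nonneg h1 h2]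

lemma sirFactor_strictMonoOn {α : ℝ} (hα : 2 < α) : StrictMonoOn (sirFactor α) (Ici 0) := by
  intro θ hθ θ' hθ' h
  rw [mem_Ici] at hθ hθ'
  have hα0 : 0 < 2 / α := by have : 0 < α := by linarith
                             positivity
  refine mul_lt_mul_of_pos_left ?_ hα0
  rw [← sub_pos, ← intervalIntegral.integral_sub
    (intervalIntegrable_sirFactor hα hθ') (intervalIntegrable_sirFactor hα hθ)]
  refine intervalIntegral.intervalIntegral_pos_of_pos_on
    ((intervalIntegrable_sirFactor hα hθ').sub (intervalIntegrable_sirFactor hα hθ)) ?_ zero_lt_one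
  intro t ht
  have h1 := mul_nonneg hθ ht.1.le
  have h2 := mul_nonneg hθ' ht.1.le
  rw [← mul_sub]
  refine mul_pos (Real.rpow_pos_of_pos ht.1 _) ?_
  rw [div_sub_div _ _ (by linarith) (by linarith)]
  have : θ' * (1 + θ * t) - (1 + θ' * t) * θ = θ' - θ := by ring
  rw [this]
  exact div_pos (by linarith) (by positivity)

lemma sirFactor_nonneg {α : ℝ} (hα : 2 < α) {θ : ℝ} (hθ : 0 ≤ θ) : 0 ≤ sirFactor α θ := by
  rw [← sirFactor_zero α]
  exact (sirFactor_strictMonoOn hα).monotoneOn self_mem_Ici hθ hθ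

lemma continuousOn_sirFactor {α : ℝ} (hα : 2 < α) : ContinuousOn (sirFactor α) (Ici 0) := by
  set C := 2 / α * ∫ t in (0 : ℝ)..1, t ^ (-(2 / α))
  refine LipschitzOnWith.continuousOn (K := C.toNNReal) ?_
  refine LipschitzOnWith.of_dist_le_mul ?_
  have key : ∀ x ∈ Ici (0 : ℝ), ∀ y ∈ Ici (0 : ℝ), x ≤ y →
      dist (sirFactor α x) (sirFactor α y) ≤ C.toNNReal * dist x y := by
    intro x hx y hy hxy
    rw [dist_comm, dist_comm x, Real.dist_eq, Real.dist_eq, abs_of_nonneg (sub_nonneg.2 hxy),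
      abs_of_nonneg (sub_nonneg.2 ((sirFactor_strictMonoOn hα).monotoneOn hx hy hxy))]
    exact (sirFactor_sub_le hα hx hxy).trans
      (mul_le_mul_of_nonneg_right (Real.le_coe_toNNReal C) (sub_nonneg.2 hxy))
  intro x hx y hy
  rcases le_total x y with h | h
  · exact key x hx y hy h
  · rw [dist_comm, dist_comm x]; exact key y hy x hx h

/-- The weight `t ^ (-(2 / α))` is at least `1` on `(0, 1)`, and without it the integral is a
logarithm. Its divergence ensures that every level of the load factor is attained. -/
lemma log_le_sirFactor {α : ℝ} (hα : 2 < α) {θ : ℝ} (hθ : 0 ≤ θ) :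
    2 / α * Real.log (1 + θ) ≤ sirFactor α θ := by
  have hα0 : 0 < α := by linarith
  refine mul_le_mul_of_nonneg_left ?_ (by positivity)
  have hpos : ∀ t ∈ uIcc (0 : ℝ) 1, 0 < 1 + θ * t := fun t ht => by
    rw [uIcc_of_le zero_le_one] at ht
    have := mul_nonneg hθ ht.1
    linarith
  have hii : IntervalIntegrable (fun t : ℝ => θ / (1 + θ * t)) volume 0 1 := by
    refine ContinuousOn.intervalIntegrable ?_
    exact continuousOn_const.div (by fun_prop) fun t ht => (hpos t ht).ne'
  have h1 : ∫ t in (0 : ℝ)..1, θ / (1 + θ * t) = Real.log (1 + θ) := by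
    rw [intervalIntegral.integral_eq_sub_of_hasDerivAt (f := fun t => Real.log (1 + θ * t))
      (fun t ht => ?_) hii]
    · simp
    · have : HasDerivAt (fun t : ℝ => 1 + θ * t) θ t := by
        simpa using ((hasDerivAt_id t).const_mul θ).const_add 1
      exact this.log (hpos t ht).ne'
  rw [← h1]
  refine intervalIntegral.integral_mono_on_of_le_Ioo zero_le_one hii
    (intervalIntegrable_sirFactor hα hθ) fun t ht => ?_
  refine le_mul_of_one_le_left (div_nonneg hθ (hpos t ?_).le) ?_
  · rw [uIcc_of_le zero_le_one]; exact Ioo_subset_Icc_self ht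
  · exact Real.one_le_rpow_of_pos_of_le_one_of_nonpos ht.1 ht.2.le
      (by rw [neg_nonpos]; positivity)

lemma tendsto_sirFactor {α : ℝ} (hα : 2 < α) : Tendsto (sirFactor α) atTop atTop := by
  have hα0 : 0 < α := by linarith
  refine tendsto_atTop_mono' _ ?_ ((Real.tendsto_log_atTop.comp
    (tendsto_atTop_add_const_left _ 1 tendsto_id)).const_mul_atTop (r := 2 / α) (by positivity))
  filter_upwards [eventually_ge_atTop 0] with θ hθ using log_le_sirFactor hα hθ

/-! ### Maximum load -/

lemma two_rpow_sub_one_nonneg {y : ℝ} (hy : 0 ≤ y) : 0 ≤ (2 : ℝ) ^ y - 1 :=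
  sub_nonneg.2 (Real.one_le_rpow (by norm_num) hy)

lemma loadFactor_strictMonoOn {α : ℝ} (hα : 2 < α) : StrictMonoOn (loadFactor α) (Ici 0) := by
  intro x hx y hy h
  rw [loadFactor_eq_sirFactor hα hx, loadFactor_eq_sirFactor hα hy]
  refine sirFactor_strictMonoOn hα (two_rpow_sub_one_nonneg hx)
    (two_rpow_sub_one_nonneg hy) ?_
  exact sub_lt_sub_right (Real.rpow_lt_rpow_of_exponent_lt (by norm_num) h) _

lemma loadFactor_zero {α : ℝ} (hα : 2 < α) : loadFactor α 0 = 0 := by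
  rw [loadFactor_eq_sirFactor hα le_rfl, Real.rpow_zero, sub_self, sirFactor_zero α]

lemma loadFactor_pos {α : ℝ} (hα : 2 < α) {y : ℝ} (hy : 0 < y) : 0 < loadFactor α y := by
  rw [← loadFactor_zero hα]
  exact loadFactor_strictMonoOn hα self_mem_Ici hy.le hy

lemma exists_loadFactor_eq {α : ℝ} (hα : 2 < α) {c : ℝ} (hc : 0 ≤ c) : ∃ y, 0 ≤ y ∧ loadFactor α y = c := by
  have h1 : ContinuousOn (fun y : ℝ => sirFactor α ((2 : ℝ) ^ y - 1)) (Ici 0) := by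
    refine (continuousOn_sirFactor hα).comp (Continuous.continuousOn ?_)
      (fun y hy => two_rpow_sub_one_nonneg hy)
    exact (Real.continuous_const_rpow (by norm_num)).sub continuous_const
  have h2 : Tendsto (fun y : ℝ => sirFactor α ((2 : ℝ) ^ y - 1)) atTop atTop := by
    refine (tendsto_sirFactor hα).comp (tendsto_atTop_add_const_right _ (-1) ?_)
    exact tendsto_rpow_atTop_of_base_gt_one 2 (by norm_num)
  obtain ⟨M, hM0, hM⟩ := ((eventually_ge_atTop (0 : ℝ)).and (h2.eventually_ge_atTop c)).exists
  have h3 := intermediate_value_Icc hM0 (h1.mono Icc_subset_Ici_self)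
  have h4 : c ∈ Icc (sirFactor α ((2 : ℝ) ^ (0 : ℝ) - 1)) (sirFactor α ((2 : ℝ) ^ M - 1)) := by
    refine ⟨?_, hM⟩
    rw [Real.rpow_zero, sub_self, sirFactor_zero α]; exact hc
  obtain ⟨y, hy, hyc⟩ := h3 h4
  exact ⟨y, hy.1, by rw [loadFactor_eq_sirFactor hα hy.1]; exact hyc⟩

/-- A load is at most the maximum load iff its load factor is at most the prescribed level. -/
lemma le_maxLoad_iff {α : ℝ} (hα : 2 < α) {A c : ℝ} (hA : 0 < A) (hc : 0 ≤ c) (k : ℕ) :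
    k ≤ maxLoad α A c ↔ loadFactor α (k * A) ≤ c := by
  obtain ⟨y, hy0, hy⟩ := exists_loadFactor_eq hα hc
  -- The equation has exactly one solution, so the supremum in `maxLoad` is that solution and not a
  -- default value.
  have hset : {κ : ℝ | 0 ≤ κ ∧ loadFactor α (κ * A) = c} = {y / A} := by
    ext κ
    simp only [mem_ofPred_eq, mem_singleton_iff]
    constructor
    · rintro ⟨h0, h⟩
      rw [eq_div_iff hA.ne']
      exact (loadFactor_strictMonoOn hα).injOn (mul_nonneg h0 hA.le) hy0 (h.trans hy.symm)
    · rintro rfl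
      exact ⟨div_nonneg hy0 hA.le, by rw [div_mul_cancel₀ _ hA.ne', hy]⟩
  rw [maxLoad, hset, csSup_singleton, Nat.le_floor_iff (div_nonneg hy0 hA.le), le_div_iff₀ hA, ← hy]
  exact ((loadFactor_strictMonoOn hα).le_iff_le (mem_Ici.2 (by positivity)) hy0).symm

/-! ### The exponential distribution -/

lemma integral_exp_neg_mul_expMeasure {a b : ℝ} (ha : 0 < a) (hb : 0 ≤ b) :
    ∫ x, Real.exp (-(b * x)) ∂(expMeasure a) = a / (a + b) := by
  have h : expMeasure a = volume.withDensity (exponentialPDF a) := rfl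
  have hm : Measurable (exponentialPDF a) := (measurable_exponentialPDFReal a).ennreal_ofReal
  rw [h, integral_withDensity_eq_integral_toReal_smul hm (ae_of_all _ fun x => by
    simp [exponentialPDF])]
  have e : (fun x => (exponentialPDF a x).toReal • Real.exp (-(b * x))) =ᵐ[volume]
      (Ioi (0 : ℝ)).indicator fun x => a * Real.exp (-(a + b) * x) := by
    have h0 : ∀ᵐ x : ℝ, x ≠ 0 := by simp [ae_iff]
    filter_upwards [h0] with x hx
    rcases lt_or_gt_of_ne hx with h | h
    · rw [exponentialPDF_of_neg h, indicator_of_notMem (by simp [h.le])]; simp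
    · rw [exponentialPDF_of_nonneg h.le, indicator_of_mem (by simpa using h),
        ENNReal.toReal_ofReal (by positivity), smul_eq_mul, mul_assoc, ← Real.exp_add]
      congr 2
      ring
  rw [integral_congr_ae e, integral_indicator measurableSet_Ioi, integral_const_mul,
    integral_exp_mul_Ioi (by linarith)]
  simp only [mul_zero, Real.exp_zero]
  rw [div_neg, neg_div, neg_neg, mul_one_div]

lemma expMeasure_real_Ici {x : ℝ} (hx : 0 ≤ x) : (expMeasure 1).real (Ici x) = Real.exp (-x) := by
  have := isProbabilityMeasure_expMeasure (zero_lt_one' ℝ)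
  have hac : expMeasure 1 ≪ volume := withDensity_absolutelyContinuous _ _
  have h1 : (expMeasure 1).real (Iic x) = 1 - Real.exp (-x) := by
    rw [← cdf_eq_real, cdf_expMeasure_eq zero_lt_one, if_pos hx, one_mul]
  have h2 : (expMeasure 1).real (Ici x) = (expMeasure 1).real (Ioi x) := by
    have : NullSingletonClass (expMeasure 1) := ⟨fun y => hac (by simp)⟩
    exact measureReal_congr Ioi_ae_eq_Ici.symm
  rw [h2, ← compl_Iic, probReal_compl_eq_one_sub measurableSet_Iic, h1]
  ring

lemma expMeasure_ae_pos : ∀ᵐ x ∂(expMeasure 1), 0 < x := by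
  have := isProbabilityMeasure_expMeasure (zero_lt_one' ℝ)
  have h1 : (expMeasure 1).real (Iic 0) = 0 := by
    rw [← cdf_eq_real, cdf_expMeasure_eq zero_lt_one]; simp
  rw [measureReal_eq_zero_iff] at h1
  rw [ae_iff]
  simpa [Iic_def] using h1

lemma lintegral_oneSubExpNeg_expMeasure {w : ℝ} (hw : 0 ≤ w) :
    ∫⁻ x, oneSubExpNeg (ENNReal.ofReal (w * x)) ∂(expMeasure 1) = ENNReal.ofReal (w / (1 + w)) := by
  have := isProbabilityMeasure_expMeasure (zero_lt_one' ℝ)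
  have e : (fun x => oneSubExpNeg (ENNReal.ofReal (w * x))) =ᵐ[expMeasure 1]
      fun x => ENNReal.ofReal (1 - Real.exp (-(w * x))) := by
    filter_upwards [expMeasure_ae_pos] with x hx
    rw [oneSubExpNeg, expNeg_ofReal (by positivity)]
  have hi : Integrable (fun x => Real.exp (-(w * x))) (expMeasure 1) := by
    refine Integrable.of_bound (by fun_prop) 1 ?_
    filter_upwards [expMeasure_ae_pos] with x hx
    rw [Real.norm_eq_abs, Real.abs_exp, Real.exp_le_one_iff, neg_nonpos]
    positivity
  have hi' : Integrable (fun x => 1 - Real.exp (-(w * x))) (expMeasure 1) :=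
    (integrable_const _).sub hi
  rw [lintegral_congr_ae e, ← ofReal_integral_eq_lintegral_ofReal hi',
    integral_sub (integrable_const _) hi, integral_exp_neg_mul_expMeasure zero_lt_one hw]
  · simp only [integral_const, probReal_univ, smul_eq_mul, mul_one]
    congr 1
    have : 1 + w ≠ 0 := by linarith
    field_simp
    ring
  · filter_upwards [expMeasure_ae_pos] with x hx
    simp only [Pi.zero_apply, sub_nonneg, Real.exp_le_one_iff, neg_nonpos]
    positivity

/-! ### Intensity of the marked process -/

/-- The marked points at distance at most `r` from the origin. -/
def disk (r : ℝ) : Set MarkedSBS := Metric.closedBall (0 : Plane) r ×ˢ univ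

lemma mem_disk {r : ℝ} {p : MarkedSBS} : p ∈ disk r ↔ ‖p.1‖ ≤ r := by simp [disk]

lemma measurableSet_disk (r : ℝ) : MeasurableSet (disk r) :=
  measurableSet_closedBall.prod MeasurableSet.univ

lemma disk_mono {r r' : ℝ} (h : r ≤ r') : disk r ⊆ disk r' := fun _ hp =>
  mem_disk.2 ((mem_disk.1 hp).trans h)

instance : IsProbabilityMeasure (expMeasure 1) := isProbabilityMeasure_expMeasure zero_lt_one

instance : IsProbabilityMeasure ((volume : Measure ℝ).restrict (Icc 0 1)) := ⟨by simp⟩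

instance (lamS : ℝ) : SigmaFinite (sbsIntensity lamS) := by
  unfold sbsIntensity ENNReal.ofReal
  exact SMul.sigmaFinite _

lemma sbsIntensity_disk {lamS : ℝ} (hS : 0 < lamS) {r : ℝ} (hr : 0 ≤ r) :
    sbsIntensity lamS (disk r) = ENNReal.ofReal (lamS * Real.pi * r ^ 2) := by
  rw [sbsIntensity, Measure.smul_apply, disk, Measure.prod_prod, measure_univ, mul_one,
    EuclideanSpace.volume_closedBall_fin_two, smul_eq_mul, ← ENNReal.ofReal_pow hr,
    ← ENNReal.ofReal_mul (by positivity), ← ENNReal.ofReal_mul hS.le]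
  congr 1
  ring

/-- Weight of a marked point in the scaled interference: `c h r ^ (-α)` for points beyond distance
`ρ` with type mark in `T`. -/
def tailTerm (α : ℝ) (T : Set ℝ) (c ρ : ℝ) (p : MarkedSBS) : ℝ≥0∞ :=
  {p : MarkedSBS | ρ < ‖p.1‖ ∧ p.2.1 ∈ T}.indicator
    (fun p => ENNReal.ofReal (c * ‖p.1‖ ^ (-α) * p.2.2)) p

lemma measurableSet_tail {T : Set ℝ} (hT : MeasurableSet T) (ρ : ℝ) :
    MeasurableSet {p : MarkedSBS | ρ < ‖p.1‖ ∧ p.2.1 ∈ T} :=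
  (measurableSet_lt measurable_const measurable_fst.norm).inter
    ((measurable_fst.comp measurable_snd) hT)

lemma measurable_tailTerm {α : ℝ} {T : Set ℝ} (hT : MeasurableSet T) (c ρ : ℝ) :
    Measurable (tailTerm α T c ρ) := by
  refine Measurable.indicator ?_ (measurableSet_tail hT ρ)
  fun_prop

lemma tailTerm_of_norm_le {α : ℝ} {T : Set ℝ} {c ρ : ℝ} {p : MarkedSBS} (h : ‖p.1‖ ≤ ρ) :
    tailTerm α T c ρ p = 0 := indicator_of_notMem (fun h' => absurd h'.1 (not_lt.2 h)) _

/-- The integral over the plane behind the load factor. -/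
lemma integral_radial {α : ℝ} (hα : 2 < α) {θ r : ℝ} (hθ : 0 ≤ θ) (hr : 0 < r) :
    ∫⁻ x : Plane, {x : Plane | r < ‖x‖}.indicator (fun x =>
      ENNReal.ofReal (θ * r ^ α * ‖x‖ ^ (-α) / (1 + θ * r ^ α * ‖x‖ ^ (-α)))) x =
      ENNReal.ofReal (Real.pi * sirFactor α θ * r ^ 2) := by
  have hα0 : 0 < α := by linarith
  -- The radial profile rescaled to inner radius `1`; in the plane the scaling produces the factor
  -- `r ^ 2`.
  let F : ℝ → ℝ := (Ioi (1 : ℝ)).indicator fun y => θ * y ^ (-α) / (1 + θ * y ^ (-α))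
  have hF0 : ∀ y, 0 ≤ F y := fun y => indicator_nonneg (fun y hy => by
    have : (0 : ℝ) < y := zero_lt_one.trans hy
    positivity) y
  have e1 : ∀ x : Plane, {x : Plane | r < ‖x‖}.indicator (fun x =>
      ENNReal.ofReal (θ * r ^ α * ‖x‖ ^ (-α) / (1 + θ * r ^ α * ‖x‖ ^ (-α)))) x =
      ENNReal.ofReal (F (r⁻¹ * ‖x‖)) := by
    intro x
    have hiff : r⁻¹ * ‖x‖ ∈ Ioi 1 ↔ r < ‖x‖ := by
      rw [mem_Ioi, ← div_eq_inv_mul, one_lt_div hr]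
    by_cases hx : r < ‖x‖
    · rw [indicator_of_mem (by exact hx)]
      simp only [F]
      rw [indicator_of_mem (hiff.2 hx), Real.mul_rpow (by positivity) (by positivity),
        Real.inv_rpow hr.le, Real.rpow_neg hr.le α, inv_inv, mul_assoc]
    · rw [indicator_of_notMem (by exact hx)]
      simp only [F]
      rw [indicator_of_notMem (fun h => hx (hiff.1 h)), ENNReal.ofReal_zero]
  -- The substitution `y = t ^ (-(1 / α))` carries `(0, 1)` onto `(1, ∞)` and turns `y ^ (-α)` into
  -- `t`.
  have hsub : ∀ t ∈ Ioi (0 : ℝ), (|-(1 / α)| * t ^ (-(1 / α) - 1)) •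
      (t ^ (-(1 / α)) * F (t ^ (-(1 / α)))) =
      (Ioo (0 : ℝ) 1).indicator (fun t => 1 / α * (t ^ (-(2 / α)) * (θ / (1 + θ * t)))) t := by
    intro t ht
    rw [mem_Ioi] at ht
    by_cases h1 : t < 1
    · have h2 : t ^ (-(1 / α)) ∈ Ioi 1 :=
        Real.one_lt_rpow_of_pos_of_lt_one_of_neg ht h1 (by rw [neg_lt_zero]; positivity)
      simp only [F]
      rw [indicator_of_mem h2, indicator_of_mem (by exact ⟨ht, h1⟩), ← Real.rpow_mul ht.le,
        abs_neg, abs_of_pos (by positivity)]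
      have e3 : -(1 / α) * -α = 1 := by field_simp
      have e4 : t ^ (-(2 / α)) = t ^ (-(1 / α) - 1) * t ^ (-(1 / α)) * t := by
        rw [← Real.rpow_add ht, ← Real.rpow_add_one ht.ne']
        congr 1
        ring
      rw [e3, Real.rpow_one, e4, smul_eq_mul]
      ring
    · have h2 : t ^ (-(1 / α)) ∉ Ioi 1 := by
        rw [mem_Ioi, not_lt]
        exact Real.rpow_le_one_of_one_le_of_nonpos (not_lt.1 h1)
          (by rw [neg_nonpos]; positivity)
      simp only [F]
      rw [indicator_of_notMem h2, indicator_of_notMem (fun h => h1 h.2), mul_zero, smul_zero]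
  have hp : -(1 / α) ≠ 0 := by rw [neg_ne_zero]; positivity
  have hI : IntegrableOn (fun y : ℝ => y * F y) (Ioi 0) := by
    rw [← integrableOn_Ioi_comp_rpow_iff _ hp, integrableOn_congr_fun hsub measurableSet_Ioi]
    refine Integrable.integrableOn ((integrable_indicator_iff measurableSet_Ioo).2 ?_)
    have := (intervalIntegrable_sirFactor hα hθ).const_mul (1 / α)
    rw [intervalIntegrable_iff_integrableOn_Ioo_of_le zero_le_one] at this
    exact this
  have hV : ∫ y in Ioi (0 : ℝ), y * F y = sirFactor α θ / 2 := by
    rw [← integral_comp_rpow_Ioi _ hp, setIntegral_congr_fun measurableSet_Ioi hsub,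
      setIntegral_indicator measurableSet_Ioo,
      inter_eq_self_of_subset_right Ioo_subset_Ioi_self, integral_const_mul, sirFactor,
      intervalIntegral.integral_of_le zero_le_one, integral_Ioc_eq_integral_Ioo]
    ring
  have hscale : ∀ y : ℝ, y ^ (Module.finrank ℝ Plane - 1) • F (r⁻¹ * y) =
      r * ((fun y => y * F y) (r⁻¹ * y)) := by
    intro y
    have : Module.finrank ℝ Plane = 2 := by simp
    rw [this, smul_eq_mul, pow_one]
    simp only
    rw [← mul_assoc, ← mul_assoc, mul_inv_cancel₀ hr.ne', one_mul]
  have hint : Integrable (fun x : Plane => F (r⁻¹ * ‖x‖)) := by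
    rw [integrable_fun_norm_addHaar volume (f := fun y => F (r⁻¹ * y))]
    simp_rw [hscale]
    refine Integrable.const_mul ?_ r
    have := (integrableOn_Ioi_comp_mul_left_iff (fun y => y * F y) 0 (inv_pos.2 hr)).2
      (by simpa using hI)
    exact this
  simp_rw [e1]
  rw [← ofReal_integral_eq_lintegral_ofReal hint (ae_of_all _ fun x => hF0 _),
    integral_fun_norm_addHaar volume (fun y => F (r⁻¹ * y))]
  simp_rw [hscale]
  rw [integral_const_mul, integral_comp_mul_left_Ioi (fun y => y * F y) 0 (inv_pos.2 hr), mul_zero,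
    hV]
  have hfr : Module.finrank ℝ Plane = 2 := by simp
  rw [hfr, measureReal_def, EuclideanSpace.volume_ball_fin_two]
  congr 1
  simp [Real.pi_pos.le]
  ring

/-- The marks are integrated out first: the exponential fading turns a weight `w` into `w / (1 +
w)`, and the type mark contributes the retained fraction of the thinning. The positions are left to
`integral_radial`. -/
lemma lintegral_oneSubExpNeg_tailTerm {lamS : ℝ} (hS : 0 < lamS) {α : ℝ} (hα : 2 < α) {T : Set ℝ}
    (hT : MeasurableSet T) {θ r : ℝ} (hθ : 0 ≤ θ) (hr : 0 < r) :
    ∫⁻ p, oneSubExpNeg (tailTerm α T (θ * r ^ α) r p) ∂(sbsIntensity lamS) =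
      ENNReal.ofReal (lamS * Real.pi * (((volume : Measure ℝ).restrict (Icc 0 1)).real T *
        sirFactor α θ) * r ^ 2) := by
  have hm : Measurable fun p => oneSubExpNeg (tailTerm α T (θ * r ^ α) r p) :=
    continuous_oneSubExpNeg.measurable.comp (measurable_tailTerm hT _ _)
  have hinner : ∀ x : Plane, ∫⁻ m : ℝ × ℝ, oneSubExpNeg (tailTerm α T (θ * r ^ α) r (x, m))
      ∂(((volume : Measure ℝ).restrict (Icc 0 1)).prod (expMeasure 1)) =
      ((volume : Measure ℝ).restrict (Icc 0 1)) T * {x : Plane | r < ‖x‖}.indicator (fun x =>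
      ENNReal.ofReal (θ * r ^ α * ‖x‖ ^ (-α) / (1 + θ * r ^ α * ‖x‖ ^ (-α)))) x := by
    intro x
    by_cases hx : r < ‖x‖
    · set w := θ * r ^ α * ‖x‖ ^ (-α) with hw
      have hw0 : 0 ≤ w := by positivity
      have e : ∀ m : ℝ × ℝ, oneSubExpNeg (tailTerm α T (θ * r ^ α) r (x, m)) =
          T.indicator 1 m.1 * oneSubExpNeg (ENNReal.ofReal (w * m.2)) := by
        intro m
        by_cases hmT : m.1 ∈ T
        · rw [tailTerm, indicator_of_mem (by exact ⟨hx, hmT⟩), indicator_of_mem hmT]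
          simp [hw]
        · rw [tailTerm, indicator_of_notMem (fun h => hmT h.2), indicator_of_notMem hmT]
          simp
      simp_rw [e]
      rw [lintegral_prod_mul (f := T.indicator 1)
        (g := fun h => oneSubExpNeg (ENNReal.ofReal (w * h)))
        ((measurable_one.indicator hT).aemeasurable)
        ((continuous_oneSubExpNeg.measurable.comp (by fun_prop)).aemeasurable),
        lintegral_indicator_one hT, lintegral_oneSubExpNeg_expMeasure hw0,
        indicator_of_mem (by exact hx)]
    · rw [indicator_of_notMem (by exact hx), mul_zero]
      simp [tailTerm_of_norm_le (α := α) (T := T) (c := θ * r ^ α) (p := (x, _)) (not_lt.1 hx)]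
  rw [sbsIntensity, lintegral_smul_measure, lintegral_prod _ hm.aemeasurable]
  simp_rw [hinner]
  rw [lintegral_const_mul' _ _ (measure_ne_top _ _), integral_radial hα hθ hr, smul_eq_mul,
    ← ENNReal.ofReal_toReal (measure_ne_top (volume.restrict (Icc (0 : ℝ) 1)) T),
    ← ENNReal.ofReal_mul ENNReal.toReal_nonneg, ← ENNReal.ofReal_mul hS.le]
  congr 1
  rw [measureReal_def]
  ring

/-! ### Almost sure properties of Poisson processes -/

section Poisson

variable {Ω X : Type*} [MeasurableSpace Ω] [MeasurableSpace X] {P : Measure Ω}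
  [IsProbabilityMeasure P] {N : Ω → Measure X} {μ : Measure X}

/-- The three exponents have disjoint supports, so `oneSubExpNeg` of their sum splits. This
expresses the independence of the counts in `A` and `B` from the points outside, in the form used on
annuli. -/
lemma IsPoissonProcess.laplace_add [SigmaFinite μ] (hN : IsPoissonProcess P N μ) {A B : Set X}
    (hA : MeasurableSet A) (hB : MeasurableSet B) (hAB : Disjoint A B) {g : X → ℝ≥0∞}
    (hg : Measurable g) (hgAB : ∀ x ∈ A ∪ B, g x = 0) (s t : ℝ≥0∞) :
    ∫ ω, expNeg (s * N ω A + t * N ω B + ∫⁻ x, g x ∂(N ω)) ∂P =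
      expNeg (oneSubExpNeg s * μ A + oneSubExpNeg t * μ B + ∫⁻ x, oneSubExpNeg (g x) ∂μ) := by
  have key : ∀ (ν : Measure X) (u v : ℝ≥0∞) (k : X → ℝ≥0∞), Measurable k →
      ∫⁻ x, (A.indicator (fun _ => u) x + B.indicator (fun _ => v) x + k x) ∂ν =
        u * ν A + v * ν B + ∫⁻ x, k x ∂ν := by
    intro ν u v k hk
    rw [lintegral_add_right _ hk, lintegral_add_right _ (measurable_const.indicator hB),
      lintegral_indicator_const hA, lintegral_indicator_const hB]
  have h := hN.laplace (f := fun x => A.indicator (fun _ => s) x + B.indicator (fun _ => t) x + g x)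
    (((measurable_const.indicator hA).add (measurable_const.indicator hB)).add hg)
  simp_rw [key _ _ _ _ hg] at h
  rw [h, ← key μ _ _ (fun x => oneSubExpNeg (g x)) (continuous_oneSubExpNeg.measurable.comp hg)]
  congr 2
  ext x
  by_cases hxA : x ∈ A
  · have hxB : x ∉ B := fun hxB => disjoint_left.1 hAB hxA hxB
    simp [hxA, hxB, hgAB x (Or.inl hxA)]
  · by_cases hxB : x ∈ B
    · simp [hxA, hxB, hgAB x (Or.inr hxB)]
    · simp [hxA, hxB]

/-- Since `∞ * 0 = 0` and `expNeg ∞ = 0`, the left side is the void probability. No finiteness of `μ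
B` is needed. -/
lemma IsPoissonProcess.laplace_top [SigmaFinite μ] (hN : IsPoissonProcess P N μ) {B : Set X}
    (hB : MeasurableSet B) : ∫ ω, expNeg (∞ * N ω B) ∂P = expNeg (μ B) := by
  simpa using hN.laplace_add hB MeasurableSet.empty (disjoint_empty B) (g := 0) measurable_const
    (by simp) ∞ 0

lemma integrable_expNeg {f : Ω → ℝ≥0∞} (hf : Measurable f) :
    Integrable (fun ω => expNeg (f ω)) P := by
  refine Integrable.of_bound (measurable_expNeg.comp hf).aestronglyMeasurable 1 (ae_of_all _ ?_)
  intro ω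
  rw [Real.norm_of_nonneg (expNeg_nonneg _)]
  exact expNeg_le_one _

/-- The void probability is `exp (-∞) = 0`. -/
lemma IsPoissonProcess.ae_ne_zero [SigmaFinite μ] (hN : IsPoissonProcess P N μ) {B : Set X}
    (hB : MeasurableSet B) (h : μ B = ∞) : ∀ᵐ ω ∂P, N ω B ≠ 0 := by
  have h1 := hN.laplace_top hB
  have hi : Integrable (fun ω => expNeg (∞ * N ω B)) P :=
    integrable_expNeg (measurable_const.mul (hN.measurable_apply hB))
  rw [h, expNeg_top, integral_eq_zero_iff_of_nonneg (fun _ => expNeg_nonneg _) hi] at h1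
  filter_upwards [h1] with ω hω h0
  simp [h0] at hω

lemma IsPoissonProcess.ae_eq_zero [SigmaFinite μ] (hN : IsPoissonProcess P N μ) {B : Set X}
    (hB : MeasurableSet B) (h : μ B = 0) : ∀ᵐ ω ∂P, N ω B = 0 := by
  have hi : Integrable (fun ω => expNeg (∞ * N ω B)) P :=
    integrable_expNeg (measurable_const.mul (hN.measurable_apply hB))
  have h1 : ∫ ω, (1 - expNeg (∞ * N ω B)) ∂P = 0 := by
    rw [integral_sub (integrable_const _) hi, hN.laplace_top hB, h]
    simp
  rw [integral_eq_zero_iff_of_nonneg (fun _ => sub_nonneg.2 (expNeg_le_one _))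
    ((integrable_const _).sub hi)] at h1
  filter_upwards [h1] with ω hω
  by_contra h0
  simp [ENNReal.top_mul h0] at hω

omit [IsProbabilityMeasure P] in
lemma IsPoissonProcess.ae_natural (hN : IsPoissonProcess P N μ) {B : Set X}
    (hB : MeasurableSet B) (h : μ B ≠ ∞) : ∀ᵐ ω ∂P, ∃ n : ℕ, N ω B = n := by
  have hs : MeasurableSet {x : ℝ≥0∞ | ∃ n : ℕ, x = n} := by
    have : {x : ℝ≥0∞ | ∃ n : ℕ, x = n} = range ((↑) : ℕ → ℝ≥0∞) := by
      ext x; simp [eq_comm]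
    rw [this]
    exact (countable_range _).measurableSet
  refine (ae_map_iff (hN.measurable_apply hB).aemeasurable hs).1 ?_
  rw [hN.law B hB h, ae_map_iff (by fun_prop) hs]
  exact ae_of_all _ fun n => ⟨n, rfl⟩

end Poisson

/-! ### Regular configurations -/

/-- Configurations with finite integer counts on disks, no point at the origin, and points of type
in `T` and of positive fading mark arbitrarily far out. -/
structure IsRegular (T : Set ℝ) (N : Measure MarkedSBS) : Prop where
  natural : ∀ q : ℚ, 0 ≤ q → ∃ n : ℕ, N (disk q) = n
  origin : N (disk 0) = 0
  far : ∀ n : ℕ, N {p | (n : ℝ) < ‖p.1‖ ∧ p.2.1 ∈ T ∧ 0 < p.2.2} ≠ 0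

lemma measurableSet_far {T : Set ℝ} (hT : MeasurableSet T) (r : ℝ) :
    MeasurableSet {p : MarkedSBS | r < ‖p.1‖ ∧ p.2.1 ∈ T ∧ 0 < p.2.2} :=
  (measurableSet_lt measurable_const measurable_fst.norm).inter
    (((measurable_fst.comp measurable_snd) hT).inter
      (measurableSet_lt measurable_const (measurable_snd.comp measurable_snd)))

lemma sbsIntensity_far {lamS : ℝ} (hS : 0 < lamS) {T : Set ℝ}
    (hTpos : (volume : Measure ℝ).restrict (Icc 0 1) T ≠ 0) (r : ℝ) :
    sbsIntensity lamS {p : MarkedSBS | r < ‖p.1‖ ∧ p.2.1 ∈ T ∧ 0 < p.2.2} = ∞ := by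
  have e : {p : MarkedSBS | r < ‖p.1‖ ∧ p.2.1 ∈ T ∧ 0 < p.2.2} =
      (Metric.closedBall (0 : Plane) r)ᶜ ×ˢ (T ×ˢ Ioi (0 : ℝ)) := by
    ext p; simp
  have h1 : (volume : Measure Plane) (Metric.closedBall (0 : Plane) r)ᶜ = ∞ := by
    rw [measure_compl measurableSet_closedBall measure_closedBall_lt_top.ne,
      measure_univ_of_isAddLeftInvariant]
    exact ENNReal.top_sub measure_closedBall_lt_top.ne
  have h2 : expMeasure 1 (Ioi 0) ≠ 0 := by
    have : expMeasure 1 (Ioi 0) = 1 := by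
      rw [← mem_ae_iff_prob_eq_one measurableSet_Ioi]
      exact expMeasure_ae_pos
    simp [this]
  rw [sbsIntensity, Measure.smul_apply, e, Measure.prod_prod, Measure.prod_prod, h1,
    ENNReal.top_mul (mul_ne_zero hTpos h2), smul_eq_mul, ENNReal.mul_top]
  simpa using hS

lemma IsPoissonProcess.ae_isRegular {Ω : Type*} [MeasurableSpace Ω] {P : Measure Ω}
    [IsProbabilityMeasure P] {lamS : ℝ} (hS : 0 < lamS) {Φ : Ω → Measure MarkedSBS}
    (hΦ : IsPoissonProcess P Φ (sbsIntensity lamS)) {T : Set ℝ} (hT : MeasurableSet T)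
    (hTpos : (volume : Measure ℝ).restrict (Icc 0 1) T ≠ 0) : ∀ᵐ ω ∂P, IsRegular T (Φ ω) := by
  have h1 : ∀ᵐ ω ∂P, ∀ q : ℚ, 0 ≤ q → ∃ n : ℕ, Φ ω (disk q) = n := by
    rw [ae_all_iff]
    intro q
    by_cases hq : 0 ≤ q
    · filter_upwards [hΦ.ae_natural (measurableSet_disk q) (by
        rw [sbsIntensity_disk hS (by exact_mod_cast hq)]; exact ENNReal.ofReal_ne_top)] with ω hω _
      exact hω
    · exact ae_of_all _ fun ω h => absurd h hq
  have h2 := hΦ.ae_eq_zero (measurableSet_disk 0) (by simp [sbsIntensity_disk hS le_rfl])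
  have h3 : ∀ᵐ ω ∂P, ∀ n : ℕ, Φ ω {p | (n : ℝ) < ‖p.1‖ ∧ p.2.1 ∈ T ∧ 0 < p.2.2} ≠ 0 :=
    ae_all_iff.2 fun n => hΦ.ae_ne_zero (measurableSet_far hT n) (sbsIntensity_far hS hTpos n)
  filter_upwards [h1, h2, h3] with ω a b c using ⟨a, b, c⟩

section Regular

variable {T : Set ℝ} {N : Measure MarkedSBS}

/-- Integrality is known only at rational radii, where countably many null sets suffice. Integer
counts attain their minimum over rational radii above `r`; by monotonicity the count is constant
just above `r`, and continuity from above extends the value to `r` itself. -/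
lemma IsRegular.natural_and_rightContinuous (hN : IsRegular T N) {r : ℝ} (hr : 0 ≤ r) :
    (∃ n : ℕ, N (disk r) = n) ∧ ∃ s, r < s ∧ N (disk s) = N (disk r) := by
  let S : Set ℕ := {n | ∃ q : ℚ, r < q ∧ N (disk q) = n}
  have hS : S.Nonempty := by
    obtain ⟨q, hq⟩ := exists_rat_gt r
    obtain ⟨n, hn⟩ := hN.natural q (by exact_mod_cast hr.trans hq.le)
    exact ⟨n, q, hq, hn⟩
  obtain ⟨q₀, hq₀, hm⟩ := Nat.sInf_mem hS
  set m := sInf S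
  have hconst : ∀ s : ℝ, r < s → s ≤ q₀ → N (disk s) = m := by
    intro s hrs hs
    refine le_antisymm (hm ▸ measure_mono (disk_mono hs)) ?_
    obtain ⟨q, hq1, hq2⟩ := exists_rat_btwn hrs
    obtain ⟨n, hn⟩ := hN.natural q (by exact_mod_cast hr.trans hq1.le)
    have hmn : m ≤ n := Nat.sInf_le ⟨q, hq1, hn⟩
    calc (m : ℝ≥0∞) ≤ n := by exact_mod_cast hmn
      _ = N (disk q) := hn.symm
      _ ≤ _ := measure_mono (disk_mono hq2.le)
  have hr' : N (disk r) = m := by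
    have hd : 0 < (q₀ : ℝ) - r := sub_pos.2 hq₀
    let u : ℕ → ℝ := fun n => r + (q₀ - r) * (1 / ((n : ℝ) + 1))
    have hu : ∀ n, r < u n ∧ u n ≤ q₀ := fun n => by
      have h1 : 0 < 1 / ((n : ℝ) + 1) := by positivity
      have h2 : 1 / ((n : ℝ) + 1) ≤ 1 := by
        rw [div_le_one (by positivity)]; linarith [n.cast_nonneg (α := ℝ)]
      constructor
      · simp only [u]; nlinarith
      · simp only [u]; nlinarith
    have hua : Antitone u := fun m n hmn => by
      simp only [u]
      gcongr
    have hut : Tendsto u atTop (𝓝 r) := by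
      have := ((tendsto_one_div_add_atTop_nhds_zero_nat (𝕜 := ℝ)).const_mul
        ((q₀ : ℝ) - r)).const_add r
      simpa [u] using this
    have hI : disk r = ⋂ n, disk (u n) := by
      refine Subset.antisymm (subset_iInter fun n => disk_mono (hu n).1.le) fun p hp => ?_
      rw [mem_disk]
      exact ge_of_tendsto' hut fun n => mem_disk.1 (mem_iInter.1 hp n)
    have ht := tendsto_measure_iInter_atTop (μ := N)
      (fun n => (measurableSet_disk (u n)).nullMeasurableSet)
      (fun i j hij => disk_mono (hua hij)) ⟨0, by rw [hconst _ (hu 0).1 (hu 0).2]; simp⟩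
    rw [← hI] at ht
    refine tendsto_nhds_unique ht (tendsto_const_nhds.congr fun n => ?_)
    exact (hconst _ (hu n).1 (hu n).2).symm
  exact ⟨⟨m, hr'⟩, q₀, hq₀, by rw [hr', hm]⟩

lemma nearestDist_nonneg (N : Measure MarkedSBS) : 0 ≤ nearestDist N :=
  Real.sInf_nonneg fun _ h => h.1

/-- Right continuity makes the infimum defining the nearest distance attained, and `far` prevents
the set of radii from being empty. Events about the nearest distance thus become void events. -/
lemma IsRegular.disk_eq_zero_iff (hN : IsRegular T N) {r : ℝ} (hr : 0 ≤ r) :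
    N (disk r) = 0 ↔ r < nearestDist N := by
  have hbdd : BddBelow {r : ℝ | 0 ≤ r ∧ 0 < N (disk r)} := ⟨0, fun _ h => h.1⟩
  have hne : {r : ℝ | 0 ≤ r ∧ 0 < N (disk r)}.Nonempty := by
    by_contra hemp
    have h0 : ∀ n : ℕ, N (disk n) = 0 := fun n => by
      by_contra h
      exact hemp ⟨n, n.cast_nonneg, pos_iff_ne_zero.2 h⟩
    refine hN.far 0 (measure_mono_null (fun p _ => ?_) (measure_iUnion_null h0))
    obtain ⟨n, hn⟩ := exists_nat_ge ‖p.1‖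
    exact mem_iUnion.2 ⟨n, mem_disk.2 hn⟩
  constructor
  · intro h0
    obtain ⟨s, hs, hs'⟩ := (hN.natural_and_rightContinuous hr).2
    refine hs.trans_le (le_csInf hne fun t ht => ?_)
    by_contra hts
    have := measure_mono_null (disk_mono (not_le.1 hts).le) (hs'.trans h0)
    exact ht.2.ne' this
  · intro h
    by_contra h0
    exact absurd (csInf_le hbdd ⟨hr, pos_iff_ne_zero.2 h0⟩) (not_le.2 h)

lemma IsRegular.nearestDist_pos (hN : IsRegular T N) : 0 < nearestDist N :=
  (hN.disk_eq_zero_iff le_rfl).1 hN.origin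

end Regular

/-! ### Measurability of the nearest distance and of the interference -/

lemma measurable_nearestDist : Measurable nearestDist := by
  refine measurable_of_Iio fun c => ?_
  -- The last alternative accounts for configurations without points, whose nearest distance is
  -- `sInf ∅ = 0`.
  have e : nearestDist ⁻¹' Iio c = {_N : Measure MarkedSBS | 0 < c} ∩
      ((⋃ q : ℚ, {N | (0 ≤ q ∧ (q : ℝ) < c) ∧ N (disk q) ≠ 0}) ∪ ⋂ n : ℕ, {N | N (disk n) = 0}) := by
    ext N
    simp only [mem_preimage, mem_Iio, mem_inter_iff, mem_union, mem_iUnion, mem_iInter,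
      mem_ofPred_eq]
    have hbdd : BddBelow {r : ℝ | 0 ≤ r ∧ 0 < N (disk r)} := ⟨0, fun _ h => h.1⟩
    constructor
    · intro h
      refine ⟨(nearestDist_nonneg N).trans_lt h, ?_⟩
      rw [or_iff_not_imp_right]
      intro h0
      push Not at h0
      obtain ⟨n, hn⟩ := h0
      obtain ⟨r, hr, hrc⟩ := (csInf_lt_iff hbdd ⟨n, n.cast_nonneg, pos_iff_ne_zero.2 hn⟩).1 h
      obtain ⟨q, hq1, hq2⟩ := exists_rat_btwn hrc
      refine ⟨q, ⟨by exact_mod_cast hr.1.trans hq1.le, hq2⟩, fun h => hr.2.ne' ?_⟩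
      exact measure_mono_null (disk_mono hq1.le) h
    · rintro ⟨hc, ⟨q, ⟨hq0, hqc⟩, hq⟩ | h0⟩
      · exact (csInf_le hbdd ⟨by exact_mod_cast hq0, pos_iff_ne_zero.2 hq⟩).trans_lt hqc
      · have : {r : ℝ | 0 ≤ r ∧ 0 < N (disk r)} = ∅ := by
          rw [eq_empty_iff_forall_notMem]
          rintro r ⟨_, hr⟩
          obtain ⟨n, hn⟩ := exists_nat_ge r
          exact hr.ne' (measure_mono_null (disk_mono hn) (h0 n))
        have h1 : nearestDist N = sInf {r : ℝ | 0 ≤ r ∧ 0 < N (disk r)} := rfl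
        rw [h1, this, Real.sInf_empty]
        exact hc
  rw [e]
  have hd : ∀ r, Measurable fun N : Measure MarkedSBS => N (disk r) := fun r =>
    Measure.measurable_coe (measurableSet_disk r)
  refine (MeasurableSet.const _).inter (MeasurableSet.union ?_ ?_)
  · exact MeasurableSet.iUnion fun q => (MeasurableSet.const _).inter
      ((hd q) (measurableSet_singleton 0).compl)
  · exact MeasurableSet.iInter fun n => (hd n) (measurableSet_singleton 0)

lemma tailTerm_mono {α : ℝ} {T : Set ℝ} {c c' ρ ρ' : ℝ} (hc0 : 0 ≤ c) (hc : c ≤ c')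
    {p : MarkedSBS} (hρ : ρ < ‖p.1‖ → ρ' < ‖p.1‖) :
    tailTerm α T c ρ p ≤ tailTerm α T c' ρ' p := by
  unfold tailTerm
  by_cases h : ρ < ‖p.1‖ ∧ p.2.1 ∈ T
  · rw [indicator_of_mem (by exact h), indicator_of_mem (by exact ⟨hρ h.1, h.2⟩),
      ENNReal.ofReal_mul (by positivity), ENNReal.ofReal_mul (mul_nonneg (hc0.trans hc)
        (by positivity))]
    gcongr
  · rw [indicator_of_notMem (by exact h)]
    exact zero_le

lemma tailTerm_eq_mul {α : ℝ} {T : Set ℝ} {c ρ : ℝ} (hc : 0 ≤ c) (p : MarkedSBS) :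
    tailTerm α T c ρ p = ENNReal.ofReal c * tailTerm α T 1 ρ p := by
  unfold tailTerm
  by_cases h : ρ < ‖p.1‖ ∧ p.2.1 ∈ T
  · rw [indicator_of_mem (by exact h), indicator_of_mem (by exact h), ← ENNReal.ofReal_mul hc]
    congr 1
    ring
  · rw [indicator_of_notMem (by exact h), indicator_of_notMem (by exact h), mul_zero]

/-- Sum of `h r ^ (-α)` over the points beyond the nearest one with type mark in `T`. -/
def shotNoise (α : ℝ) (T : Set ℝ) (N : Measure MarkedSBS) : ℝ≥0∞ :=
  ∫⁻ p, tailTerm α T 1 (nearestDist N) p ∂N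

-- The inner radius of the integral depends on the configuration, so measurability in `N` is not
-- immediate. By monotone convergence it can be replaced by a countable supremum over fixed rational
-- radii.
open Classical in
lemma shotNoise_eq_iSup {α : ℝ} {T : Set ℝ} (hT : MeasurableSet T) (N : Measure MarkedSBS) :
    shotNoise α T N =
      ⨆ q : ℚ, if nearestDist N < q then ∫⁻ p, tailTerm α T 1 q p ∂N else 0 := by
  set R := nearestDist N with hR
  refine le_antisymm ?_ (iSup_le fun q => ?_)
  · let u : ℕ → ℝ := fun n => R + 1 / ((n : ℝ) + 1)
    have hua : Antitone u := fun m n hmn => by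
      simp only [u]
      gcongr
    have hu : ∀ n, R < u n := fun n => by simp only [u]; linarith [n.one_div_pos_of_nat (α := ℝ)]
    have hut : Tendsto u atTop (𝓝 R) := by
      simpa [u] using (tendsto_one_div_add_atTop_nhds_zero_nat (𝕜 := ℝ)).const_add R
    have e : ∀ p, tailTerm α T 1 R p = ⨆ n, tailTerm α T 1 (u n) p := by
      intro p
      refine le_antisymm ?_ (iSup_le fun n => tailTerm_mono zero_le_one le_rfl (hu n).trans)
      by_cases hp : R < ‖p.1‖
      · obtain ⟨n, hn⟩ := (hut.eventually_lt_const hp).exists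
        exact le_iSup_of_le n (tailTerm_mono zero_le_one le_rfl fun _ => hn)
      · rw [tailTerm_of_norm_le (not_lt.1 hp)]
        exact zero_le
    have h1 : shotNoise α T N = ⨆ n, ∫⁻ p, tailTerm α T 1 (u n) p ∂N := by
      rw [← lintegral_iSup (fun n => measurable_tailTerm hT _ _)
        (fun m n hmn p => tailTerm_mono zero_le_one le_rfl (hua hmn).trans_lt), shotNoise]
      simp_rw [← hR, e]
    rw [h1]
    refine iSup_le fun n => ?_
    obtain ⟨q, hq1, hq2⟩ := exists_rat_btwn (hu n)
    refine le_iSup_of_le q ?_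
    rw [if_pos hq1]
    exact lintegral_mono fun p => tailTerm_mono zero_le_one le_rfl hq2.trans
  · split_ifs with hq
    · exact lintegral_mono fun p => tailTerm_mono zero_le_one le_rfl hq.trans
    · exact zero_le

lemma measurable_shotNoise {α : ℝ} {T : Set ℝ} (hT : MeasurableSet T) :
    Measurable (shotNoise α T) := by
  classical
  rw [show shotNoise α T = _ from funext fun N => shotNoise_eq_iSup hT N]
  refine Measurable.iSup fun q => Measurable.ite ?_
    (Measure.measurable_lintegral (measurable_tailTerm hT _ _)) measurable_const
  exact measurable_nearestDist measurableSet_Iio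

/-- With zero interference the quotient in the rate would be `0` by convention and the rate would
vanish, although the SIR is infinite. The points supplied by `far` exclude this case. -/
lemma IsRegular.shotNoise_ne_zero {α : ℝ} {T : Set ℝ} (hT : MeasurableSet T)
    {N : Measure MarkedSBS} (hN : IsRegular T N) : shotNoise α T N ≠ 0 := by
  rw [shotNoise, Ne, lintegral_eq_zero_iff (measurable_tailTerm hT _ _)]
  intro h
  obtain ⟨n, hn⟩ := exists_nat_ge (nearestDist N)
  refine hN.far n (measure_mono_null (fun p hp => ?_) (ae_iff.1 h))
  have h1 : nearestDist N < ‖p.1‖ := hn.trans_lt hp.1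
  have h2 : 0 < ‖p.1‖ := (nearestDist_nonneg N).trans_lt h1
  have h3 := hp.2.2
  rw [mem_ofPred_eq, tailTerm, indicator_of_mem (by exact ⟨h1, hp.2.1⟩), Pi.zero_apply,
    ENNReal.ofReal_eq_zero, not_le]
  positivity

lemma interference_eq_shotNoise {s : SystemParams} (hPa : 0 ≤ s.Pa) (hβ : 0 ≤ s.β) {T : Set ℝ}
    (hT : MeasurableSet T) (N : Measure MarkedSBS) :
    interference s T N = s.Pa * s.β * (shotNoise s.α T N).toReal := by
  have h := mul_nonneg hPa hβ
  rw [interference, ← lintegral_indicator (measurableSet_tail hT _), shotNoise,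
    ← ENNReal.toReal_ofReal h, ← ENNReal.toReal_mul,
    ← lintegral_const_mul _ (measurable_tailTerm hT _ _)]
  congr 2
  ext p
  rw [← tailTerm_eq_mul h, tailTerm]
  congr 2
  ext p
  rw [pathLoss]
  congr 1
  ring

/-! ### Law of the nearest distance -/

/-- The fading gain that the serving link needs for the SIR to reach `θ`. -/
def thresholdGain (α : ℝ) (T : Set ℝ) (θ : ℝ) (N : Measure MarkedSBS) : ℝ≥0∞ :=
  ENNReal.ofReal (θ * nearestDist N ^ α) * shotNoise α T N

lemma measurable_thresholdGain {α : ℝ} {T : Set ℝ} (hT : MeasurableSet T) (θ : ℝ) :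
    Measurable (thresholdGain α T θ) :=
  ((measurable_nearestDist.pow_const α).const_mul θ).ennreal_ofReal.mul (measurable_shotNoise hT)

lemma thresholdGain_eq_lintegral {α : ℝ} {T : Set ℝ} (hT : MeasurableSet T) {θ : ℝ} (hθ : 0 ≤ θ)
    (N : Measure MarkedSBS) : thresholdGain α T θ N =
      ∫⁻ p, tailTerm α T (θ * nearestDist N ^ α) (nearestDist N) p ∂N := by
  have h : 0 ≤ θ * nearestDist N ^ α := mul_nonneg hθ (Real.rpow_nonneg (nearestDist_nonneg N) _)
  rw [thresholdGain, shotNoise, ← lintegral_const_mul _ (measurable_tailTerm hT _ _)]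
  simp_rw [← tailTerm_eq_mul h]

section Network

variable {Ω : Type*} [MeasurableSpace Ω] {P : Measure Ω} [IsProbabilityMeasure P] {lamS : ℝ}
  {Φ : Ω → Measure MarkedSBS} {T : Set ℝ}

lemma integral_void (hS : 0 < lamS) (hΦ : IsPoissonProcess P Φ (sbsIntensity lamS))
    {r : ℝ} (hr : 0 ≤ r) :
    ∫ ω, expNeg (∞ * Φ ω (disk r)) ∂P = Real.exp (-(lamS * Real.pi * r ^ 2)) := by
  rw [hΦ.laplace_top (measurableSet_disk r), sbsIntensity_disk hS hr, expNeg_ofReal (by positivity)]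

lemma IsRegular.expNeg_disk {N : Measure MarkedSBS} (hN : IsRegular T N) {r : ℝ} (hr : 0 ≤ r) :
    expNeg (∞ * N (disk r)) = {N | r < nearestDist N}.indicator 1 N := by
  by_cases h : r < nearestDist N
  · rw [indicator_of_mem (by exact h), (hN.disk_eq_zero_iff hr).2 h]; simp
  · rw [indicator_of_notMem (by exact h), ENNReal.top_mul (fun h0 =>
      h ((hN.disk_eq_zero_iff hr).1 h0)), expNeg_top]

/-- The squared distance to the nearest point is exponentially distributed. -/
lemma map_nearestDist_sq (hS : 0 < lamS) (hΦ : IsPoissonProcess P Φ (sbsIntensity lamS))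
    (hT : MeasurableSet T) (hTpos : (volume : Measure ℝ).restrict (Icc 0 1) T ≠ 0) :
    P.map (fun ω => nearestDist (Φ ω) ^ 2) = expMeasure (lamS * Real.pi) := by
  have ha : 0 < lamS * Real.pi := by positivity
  have := isProbabilityMeasure_expMeasure ha
  have hR : Measurable fun ω => nearestDist (Φ ω) := measurable_nearestDist.comp hΦ.measurable
  have hm : Measurable fun ω => nearestDist (Φ ω) ^ 2 := hR.pow_const 2
  have := Measure.isProbabilityMeasure_map (μ := P) hm.aemeasurable
  refine Measure.eq_of_cdf _ _ ?_
  ext x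
  rw [cdf_expMeasure_eq ha, cdf_eq_real, map_measureReal_apply hm measurableSet_Iic]
  split_ifs with hx
  · have h1 : P.real {ω | √x < nearestDist (Φ ω)} = Real.exp (-(lamS * Real.pi * x)) := by
      have h2 := integral_void hS hΦ (Real.sqrt_nonneg x)
      rw [Real.sq_sqrt hx] at h2
      rw [← h2, ← integral_indicator_one (measurableSet_lt measurable_const hR)]
      refine integral_congr_ae ?_
      filter_upwards [hΦ.ae_isRegular hS hT hTpos] with ω hω
      rw [hω.expNeg_disk (Real.sqrt_nonneg x)]
      rfl
    rw [← h1, ← probReal_compl_eq_one_sub (measurableSet_lt measurable_const hR)]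
    congr 1
    ext ω
    rw [mem_preimage, mem_Iic, mem_compl_iff, mem_ofPred_eq, not_lt,
      Real.le_sqrt (nearestDist_nonneg _) hx]
  · rw [measureReal_eq_zero_iff]
    convert measure_empty (μ := P)
    ext ω
    simp only [mem_preimage, mem_Iic, mem_empty_iff_false, iff_false, not_le]
    exact (not_le.1 hx).trans_le (sq_nonneg _)

/-- The Laplace transform of the exponential law of `R ^ 2`. At `b = G` it is the coverage value
sought; the annulus bounds lead to values of `b` close to `G`. -/
lemma integral_exp_neg_nearestDist_sq (hS : 0 < lamS)
    (hΦ : IsPoissonProcess P Φ (sbsIntensity lamS)) (hT : MeasurableSet T)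
    (hTpos : (volume : Measure ℝ).restrict (Icc 0 1) T ≠ 0) {b : ℝ} (hb : 0 ≤ b) :
    ∫ ω, Real.exp (-(lamS * Real.pi * b * nearestDist (Φ ω) ^ 2)) ∂P = 1 / (1 + b) := by
  have ha : 0 < lamS * Real.pi := by positivity
  have hR : Measurable fun ω => nearestDist (Φ ω) := measurable_nearestDist.comp hΦ.measurable
  have h := integral_exp_neg_mul_expMeasure ha (b := lamS * Real.pi * b) (by positivity)
  rw [← map_nearestDist_sq hS hΦ hT hTpos, integral_map (hR.pow_const 2).aemeasurable
    (by fun_prop)] at h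
  rw [h]
  field_simp

/-! ### Annulus bounds for the coverage functional -/

lemma measureReal_nearestDist_annulus (hS : 0 < lamS)
    (hΦ : IsPoissonProcess P Φ (sbsIntensity lamS)) (hT : MeasurableSet T)
    (hTpos : (volume : Measure ℝ).restrict (Icc 0 1) T ≠ 0) {r ρ : ℝ} (hr : 0 ≤ r) (hrρ : r ≤ ρ) :
    P.real {ω | r < nearestDist (Φ ω) ∧ nearestDist (Φ ω) ≤ ρ} =
      Real.exp (-(lamS * Real.pi * r ^ 2)) - Real.exp (-(lamS * Real.pi * ρ ^ 2)) := by
  have hR : Measurable fun ω => nearestDist (Φ ω) := measurable_nearestDist.comp hΦ.measurable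
  have hE : MeasurableSet {ω | r < nearestDist (Φ ω) ∧ nearestDist (Φ ω) ≤ ρ} :=
    (measurableSet_lt measurable_const hR).inter (measurableSet_le hR measurable_const)
  have hi : ∀ r, Integrable (fun ω => expNeg (∞ * Φ ω (disk r))) P := fun r =>
    integrable_expNeg (measurable_const.mul (hΦ.measurable_apply (measurableSet_disk r)))
  rw [← integral_void hS hΦ hr, ← integral_void hS hΦ (hr.trans hrρ),
    ← integral_sub (hi r) (hi ρ), ← integral_indicator_one hE]
  refine integral_congr_ae ?_
  filter_upwards [hΦ.ae_isRegular hS hT hTpos] with ω hω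
  rw [hω.expNeg_disk hr, hω.expNeg_disk (hr.trans hrρ)]
  simp only [indicator, mem_ofPred_eq, Pi.one_apply]
  by_cases h1 : r < nearestDist (Φ ω)
  · by_cases h2 : nearestDist (Φ ω) ≤ ρ
    · simp [h1, h2, not_lt.2 h2]
    · simp [h1, h2, not_le.1 h2]
  · have h2 : ¬ ρ < nearestDist (Φ ω) := fun h => h1 (hrρ.trans_lt h)
    simp [h1, h2]

/-- Moving the inner radius from `r` to `ρ` discards only the points of the annulus, and since
`oneSubExpNeg ≤ 1` they cost at most the intensity of the annulus in the exponent. -/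
lemma expNeg_tail_le (hS : 0 < lamS) {α : ℝ} (hα : 2 < α) (hT : MeasurableSet T) {θ r ρ : ℝ}
    (hθ : 0 ≤ θ) (hr : 0 < r) (hrρ : r ≤ ρ) :
    expNeg (∫⁻ p, oneSubExpNeg (tailTerm α T (θ * r ^ α) ρ p) ∂(sbsIntensity lamS)) ≤
      Real.exp (-(lamS * Real.pi * (((volume : Measure ℝ).restrict (Icc 0 1)).real T *
        sirFactor α θ) * r ^ 2)) * Real.exp (lamS * Real.pi * (ρ ^ 2 - r ^ 2)) := by
  have hF := sirFactor_nonneg hα hθ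
  have hd : 0 ≤ ρ ^ 2 - r ^ 2 := by nlinarith
  set U := (volume : Measure ℝ).restrict (Icc 0 1)
  set W := ∫⁻ p, oneSubExpNeg (tailTerm α T (θ * r ^ α) ρ p) ∂(sbsIntensity lamS)
  have hann : sbsIntensity lamS (disk ρ \ disk r) =
      ENNReal.ofReal (lamS * Real.pi * (ρ ^ 2 - r ^ 2)) := by
    rw [measure_sdiff (disk_mono hrρ) (measurableSet_disk r).nullMeasurableSet
      (by rw [sbsIntensity_disk hS hr.le]; exact ENNReal.ofReal_ne_top),
      sbsIntensity_disk hS hr.le, sbsIntensity_disk hS (hr.le.trans hrρ),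
      ← ENNReal.ofReal_sub _ (by positivity), mul_sub]
  have hle : ENNReal.ofReal (lamS * Real.pi * (U.real T * sirFactor α θ) * r ^ 2) ≤
      W + ENNReal.ofReal (lamS * Real.pi * (ρ ^ 2 - r ^ 2)) := by
    have hA := (measurableSet_disk ρ).diff (measurableSet_disk r)
    rw [← lintegral_oneSubExpNeg_tailTerm hS hα hT hθ hr, ← hann, ← lintegral_indicator_one hA,
      ← lintegral_add_right _ (measurable_one.indicator hA)]
    refine lintegral_mono fun p => ?_
    by_cases hp : ‖p.1‖ ≤ r
    · rw [tailTerm_of_norm_le hp]; simp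
    by_cases hp' : ‖p.1‖ ≤ ρ
    · rw [indicator_of_mem (by exact ⟨mem_disk.2 hp', fun h => hp (mem_disk.1 h)⟩)]
      refine le_add_left ?_
      rw [oneSubExpNeg, Pi.one_apply, ENNReal.ofReal_le_one]
      linarith [expNeg_nonneg (tailTerm α T (θ * r ^ α) r p)]
    · exact le_add_right (monotone_oneSubExpNeg
        (tailTerm_mono (by positivity) le_rfl fun _ => not_le.1 hp'))
  have h1 := expNeg_antitone hle
  rw [expNeg_add, expNeg_ofReal (by positivity), expNeg_ofReal (by positivity)] at h1
  calc expNeg W = expNeg W * Real.exp (-(lamS * Real.pi * (ρ ^ 2 - r ^ 2))) *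
        Real.exp (lamS * Real.pi * (ρ ^ 2 - r ^ 2)) := by
        rw [mul_assoc, ← Real.exp_add]; simp
    _ ≤ _ := mul_le_mul_of_nonneg_right h1 (Real.exp_pos _).le

/-- For `r < R ≤ ρ` the threshold only decreases when `R ^ α` is replaced by `r ^ α` and the points
up to `ρ` are dropped. The event is a difference of two void events inside the disk of radius `ρ`,
hence independent of the remaining points. -/
lemma setIntegral_expNeg_thresholdGain_le (hS : 0 < lamS)
    (hΦ : IsPoissonProcess P Φ (sbsIntensity lamS)) (hT : MeasurableSet T)
    (hTpos : (volume : Measure ℝ).restrict (Icc 0 1) T ≠ 0) {α : ℝ} (hα : 2 < α) {θ r ρ : ℝ}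
    (hθ : 0 ≤ θ) (hr : 0 < r) (hrρ : r ≤ ρ) :
    ∫ ω in {ω | r < nearestDist (Φ ω) ∧ nearestDist (Φ ω) ≤ ρ},
        expNeg (thresholdGain α T θ (Φ ω)) ∂P ≤
      P.real {ω | r < nearestDist (Φ ω) ∧ nearestDist (Φ ω) ≤ ρ} *
      (Real.exp (-(lamS * Real.pi * (((volume : Measure ℝ).restrict (Icc 0 1)).real T *
        sirFactor α θ) * r ^ 2)) * Real.exp (lamS * Real.pi * (ρ ^ 2 - r ^ 2))) := by
  have hρ : 0 ≤ ρ := hr.le.trans hrρ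
  have hα0 : 0 ≤ α := by linarith
  have hR : Measurable fun ω => nearestDist (Φ ω) := measurable_nearestDist.comp hΦ.measurable
  have hE : MeasurableSet {ω | r < nearestDist (Φ ω) ∧ nearestDist (Φ ω) ≤ ρ} :=
    (measurableSet_lt measurable_const hR).inter (measurableSet_le hR measurable_const)
  have hg := measurable_tailTerm (α := α) hT (θ * r ^ α) ρ
  have hL : ∀ t, 0 ≤ t → t ≤ ρ → ∫ ω, expNeg (∞ * Φ ω (disk t) +
      ∫⁻ p, tailTerm α T (θ * r ^ α) ρ p ∂(Φ ω)) ∂P = Real.exp (-(lamS * Real.pi * t ^ 2)) *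
      expNeg (∫⁻ p, oneSubExpNeg (tailTerm α T (θ * r ^ α) ρ p) ∂(sbsIntensity lamS)) := by
    intro t ht htρ
    have h := hΦ.laplace_add (measurableSet_disk t) MeasurableSet.empty (disjoint_empty _) hg
      (fun p hp => tailTerm_of_norm_le ((mem_disk.1 (by simpa using hp)).trans htρ)) ∞ 0
    simp only [zero_mul, add_zero, oneSubExpNeg_top, one_mul, oneSubExpNeg_zero] at h
    rw [h, expNeg_add, sbsIntensity_disk hS ht, expNeg_ofReal (by positivity)]
  have hi : ∀ t, Integrable (fun ω => expNeg (∞ * Φ ω (disk t) +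
      ∫⁻ p, tailTerm α T (θ * r ^ α) ρ p ∂(Φ ω))) P := fun t =>
    integrable_expNeg ((measurable_const.mul (hΦ.measurable_apply (measurableSet_disk t))).add
      (hΦ.measurable_lintegral hg))
  rw [measureReal_nearestDist_annulus hS hΦ hT hTpos hr.le hrρ]
  refine le_trans ?_ (mul_le_mul_of_nonneg_left (expNeg_tail_le hS hα hT hθ hr hrρ) ?_)
  · rw [sub_mul, ← hL r hr.le hrρ, ← hL ρ hρ le_rfl, ← integral_sub (hi r) (hi ρ),
      ← integral_indicator hE]
    refine integral_mono_ae ((integrable_expNeg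
      ((measurable_thresholdGain hT θ).comp hΦ.measurable)).indicator hE) ((hi r).sub (hi ρ)) ?_
    filter_upwards [hΦ.ae_isRegular hS hT hTpos] with ω hω
    rw [expNeg_add, expNeg_add, hω.expNeg_disk hr.le, hω.expNeg_disk hρ, ← sub_mul]
    by_cases h1 : r < nearestDist (Φ ω)
    · by_cases h2 : nearestDist (Φ ω) ≤ ρ
      · rw [indicator_of_mem (by exact ⟨h1, h2⟩), indicator_of_mem (by exact h1),
          indicator_of_notMem (by exact not_lt.2 h2), Pi.one_apply, sub_zero, one_mul,
          thresholdGain_eq_lintegral hT hθ]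
        refine expNeg_antitone (lintegral_mono fun p => ?_)
        exact tailTerm_mono (by positivity) (by gcongr) h2.trans_lt
      · rw [indicator_of_notMem (by exact fun h => h2 h.2), indicator_of_mem (by exact h1),
          indicator_of_mem (by exact not_le.1 h2), sub_self, zero_mul]
    · rw [indicator_of_notMem (by exact fun h => h1 h.1), indicator_of_notMem (by exact h1),
        indicator_of_notMem (by exact fun h => h1 (hrρ.trans_lt h)), sub_self, zero_mul]
  · rw [sub_nonneg, Real.exp_le_exp, neg_le_neg_iff]
    gcongr

end Network

section Network

variable {Ω : Type*} [MeasurableSpace Ω] {P : Measure Ω} [IsProbabilityMeasure P] {lamS : ℝ}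
  {Φ : Ω → Measure MarkedSBS} {T : Set ℝ}

lemma disk_union_annulus {r ρ : ℝ} (hrρ : r ≤ ρ) : disk ρ = disk r ∪ (disk ρ \ disk r) :=
  (union_sdiff_cancel (disk_mono hrρ)).symm

/-- On a regular configuration with nearest point in an annulus holding exactly one point, the
threshold gain is at most the tail integral over the complement of the annulus. -/
lemma IsRegular.thresholdGain_le {N : Measure MarkedSBS} (hN : IsRegular T N)
    (hT : MeasurableSet T) {α θ ρ : ℝ} (hα : 0 ≤ α) (hθ : 0 ≤ θ) (hRρ : nearestDist N ≤ ρ)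
    (h1 : N (disk ρ) = 1) :
    thresholdGain α T θ N ≤ ∫⁻ p, tailTerm α T (θ * ρ ^ α) ρ p ∂N := by
  have hR0 := nearestDist_nonneg N
  -- The infimum is attained, so this count is a nonzero integer, and it is at most the count `1` of
  -- the larger disk. Hence there is no mass strictly between the nearest distance and `ρ`.
  have hR : N (disk (nearestDist N)) = 1 := by
    obtain ⟨n, hn⟩ := (hN.natural_and_rightContinuous hR0).1
    have h0 : N (disk (nearestDist N)) ≠ 0 := fun h =>
      lt_irrefl _ ((hN.disk_eq_zero_iff hR0).1 h)
    refine le_antisymm (h1 ▸ measure_mono (disk_mono hRρ)) ?_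
    rw [hn] at h0 ⊢
    have : n ≠ 0 := by exact_mod_cast h0
    exact_mod_cast Nat.one_le_iff_ne_zero.2 this
  have hnull : N (disk ρ \ disk (nearestDist N)) = 0 := by
    rw [measure_sdiff (disk_mono hRρ) (measurableSet_disk _).nullMeasurableSet (by simp [hR]),
      h1, hR, tsub_self]
  rw [thresholdGain_eq_lintegral hT hθ]
  refine lintegral_mono_ae ?_
  filter_upwards [measure_eq_zero_iff_ae_notMem.1 hnull] with p hp
  refine tailTerm_mono (by positivity) (by gcongr) fun hp' => ?_
  by_contra hpρ
  exact hp ⟨mem_disk.2 (not_lt.1 hpρ), fun h => absurd (mem_disk.1 h) (not_le.2 hp')⟩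

/-- With `n` points in the annulus, `(x ^ n - 0 ^ n) / x` equals `0` for `n = 0`, `1` for `n = 1`,
and is at most `x` for `n ≥ 2`. Up to the error `x` it therefore selects the configurations with
exactly one point there, using Laplace exponents only (`-log x` and `∞`). -/
lemma IsRegular.indicator_expNeg_ge {N : Measure MarkedSBS} (hN : IsRegular T N)
    (hT : MeasurableSet T) {α θ r ρ x : ℝ} (hα : 0 ≤ α) (hθ : 0 ≤ θ) (hr : 0 ≤ r) (hrρ : r ≤ ρ)
    (hx0 : 0 < x) (hx1 : x ≤ 1) :
    x⁻¹ * (expNeg (∞ * N (disk r) + ENNReal.ofReal (-Real.log x) * N (disk ρ \ disk r) +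
        ∫⁻ p, tailTerm α T (θ * ρ ^ α) ρ p ∂N) -
      expNeg (∞ * N (disk r) + ∞ * N (disk ρ \ disk r) +
        ∫⁻ p, tailTerm α T (θ * ρ ^ α) ρ p ∂N)) - x ≤
    {N | r < nearestDist N ∧ nearestDist N ≤ ρ}.indicator
      (fun N => expNeg (thresholdGain α T θ N)) N := by
  set Z := ∫⁻ p, tailTerm α T (θ * ρ ^ α) ρ p ∂N
  have hrhs : 0 ≤ {N | r < nearestDist N ∧ nearestDist N ≤ ρ}.indicator
      (fun N => expNeg (thresholdGain α T θ N)) N :=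
    indicator_nonneg (fun _ _ => expNeg_nonneg _) _
  by_cases h0 : N (disk r) = 0
  · have hrR := (hN.disk_eq_zero_iff hr).1 h0
    have hann : N (disk ρ \ disk r) = N (disk ρ) := by
      rw [measure_sdiff (disk_mono hrρ) (measurableSet_disk _).nullMeasurableSet (by simp [h0]),
        h0, tsub_zero]
    obtain ⟨n, hn⟩ := (hN.natural_and_rightContinuous (hr.trans hrρ)).1
    rw [hann, hn, h0, mul_zero, zero_add, zero_add, expNeg_add, expNeg_add, expNeg_mul_natCast,
      expNeg_mul_natCast, expNeg_ofReal (neg_nonneg.2 (Real.log_nonpos hx0.le hx1)), neg_neg,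
      Real.exp_log hx0, expNeg_top]
    have hZ0 := expNeg_nonneg Z
    have hZ1 := expNeg_le_one Z
    match n, hn with
    | 0, _ => simpa using (neg_nonpos.2 hx0.le).trans hrhs
    | 1, hn =>
      have hRρ : nearestDist N ≤ ρ := by
        by_contra h
        rw [(hN.disk_eq_zero_iff (hr.trans hrρ)).2 (not_le.1 h)] at hn
        simp at hn
      rw [indicator_of_mem (by exact ⟨hrR, hRρ⟩)]
      have := expNeg_antitone (hN.thresholdGain_le hT hα hθ hRρ (by simpa using hn))
      rw [pow_one, pow_one, zero_mul, sub_zero, inv_mul_cancel_left₀ hx0.ne']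
      linarith
    | n + 2, _ =>
      refine le_trans ?_ hrhs
      have h2 : x⁻¹ * (x ^ (n + 2) * expNeg Z) = x * (x ^ n * expNeg Z) := by
        field_simp
        ring
      rw [zero_pow (by omega), zero_mul, sub_zero, h2, sub_nonpos]
      refine mul_le_of_le_one_right hx0.le (mul_le_one₀ (pow_le_one₀ hx0.le hx1) hZ0 hZ1)
  · rw [ENNReal.top_mul h0]
    simpa using (neg_nonpos.2 hx0.le).trans hrhs

/-- The integral is restricted to configurations with exactly one point up to `ρ`, lying beyond `r`.
There every interferer is beyond `ρ`, so the threshold is at most a functional independent of the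
annulus. Discarding two or more points costs only a factor close to `1` for thin annuli. -/
lemma le_setIntegral_expNeg_thresholdGain (hS : 0 < lamS)
    (hΦ : IsPoissonProcess P Φ (sbsIntensity lamS)) (hT : MeasurableSet T)
    (hTpos : (volume : Measure ℝ).restrict (Icc 0 1) T ≠ 0) {α : ℝ} (hα : 2 < α) {θ r ρ : ℝ}
    (hθ : 0 ≤ θ) (hr : 0 < r) (hrρ : r ≤ ρ) :
    P.real {ω | r < nearestDist (Φ ω) ∧ nearestDist (Φ ω) ≤ ρ} *
      (Real.exp (-(lamS * Real.pi * (((volume : Measure ℝ).restrict (Icc 0 1)).real T *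
        sirFactor α θ) * ρ ^ 2)) * Real.exp (-(lamS * Real.pi * (ρ ^ 2 - r ^ 2)))) ≤
    ∫ ω in {ω | r < nearestDist (Φ ω) ∧ nearestDist (Φ ω) ≤ ρ},
        expNeg (thresholdGain α T θ (Φ ω)) ∂P := by
  have hρ : 0 < ρ := hr.trans_le hrρ
  have hα0 : 0 ≤ α := by linarith
  have hd : 0 ≤ ρ ^ 2 - r ^ 2 := by nlinarith
  have hF := sirFactor_nonneg hα hθ
  have hR : Measurable fun ω => nearestDist (Φ ω) := measurable_nearestDist.comp hΦ.measurable
  have hE : MeasurableSet {ω | r < nearestDist (Φ ω) ∧ nearestDist (Φ ω) ≤ ρ} :=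
    (measurableSet_lt measurable_const hR).inter (measurableSet_le hR measurable_const)
  have hg := measurable_tailTerm (α := α) hT (θ * ρ ^ α) ρ
  set m := lamS * Real.pi * (ρ ^ 2 - r ^ 2) with hm
  have hm0 : 0 ≤ m := by positivity
  set V := lamS * Real.pi * (((volume : Measure ℝ).restrict (Icc 0 1)).real T *
        sirFactor α θ) * ρ ^ 2 with hV
  have hV0 : 0 ≤ V := by positivity
  have hA := (measurableSet_disk ρ).diff (measurableSet_disk r)
  have hann : sbsIntensity lamS (disk ρ \ disk r) = ENNReal.ofReal m := by
    rw [measure_sdiff (disk_mono hrρ) (measurableSet_disk r).nullMeasurableSet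
      (by rw [sbsIntensity_disk hS hr.le]; exact ENNReal.ofReal_ne_top),
      sbsIntensity_disk hS hr.le, sbsIntensity_disk hS hρ.le,
      ← ENNReal.ofReal_sub _ (by positivity), hm, mul_sub]
  have hL : ∀ t : ℝ≥0∞, ∫ ω, expNeg (∞ * Φ ω (disk r) + t * Φ ω (disk ρ \ disk r) +
      ∫⁻ p, tailTerm α T (θ * ρ ^ α) ρ p ∂(Φ ω)) ∂P = Real.exp (-(lamS * Real.pi * r ^ 2)) *
      Real.exp (-((1 - expNeg t) * m)) * Real.exp (-V) := by
    intro t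
    have h1 : 0 ≤ 1 - expNeg t := sub_nonneg.2 (expNeg_le_one t)
    rw [hΦ.laplace_add (measurableSet_disk r) hA disjoint_sdiff_right hg (fun p hp => by
        rw [← disk_union_annulus hrρ] at hp
        exact tailTerm_of_norm_le (mem_disk.1 hp)),
      lintegral_oneSubExpNeg_tailTerm hS hα hT hθ hρ, expNeg_add, expNeg_add, hann,
      sbsIntensity_disk hS hr.le, oneSubExpNeg_top, one_mul, oneSubExpNeg, ← ENNReal.ofReal_mul h1,
      expNeg_ofReal (by positivity), expNeg_ofReal (by positivity), expNeg_ofReal hV0]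
  have hi : ∀ t : ℝ≥0∞, Integrable (fun ω => expNeg (∞ * Φ ω (disk r) +
      t * Φ ω (disk ρ \ disk r) + ∫⁻ p, tailTerm α T (θ * ρ ^ α) ρ p ∂(Φ ω))) P := fun t =>
    integrable_expNeg (((measurable_const.mul (hΦ.measurable_apply (measurableSet_disk r))).add
      (measurable_const.mul (hΦ.measurable_apply hA))).add (hΦ.measurable_lintegral hg))
  have key : ∀ x : ℝ, 0 < x → x ≤ 1 →
      Real.exp (-(lamS * Real.pi * r ^ 2)) * (m * Real.exp (-m)) * Real.exp (-V) - x ≤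
      ∫ ω in {ω | r < nearestDist (Φ ω) ∧ nearestDist (Φ ω) ≤ ρ},
        expNeg (thresholdGain α T θ (Φ ω)) ∂P := by
    intro x hx0 hx1
    have hlog : expNeg (ENNReal.ofReal (-Real.log x)) = x := by
      rw [expNeg_ofReal (neg_nonneg.2 (Real.log_nonpos hx0.le hx1)), neg_neg, Real.exp_log hx0]
    have h1 : ∫ ω, (x⁻¹ * (expNeg (∞ * Φ ω (disk r) + ENNReal.ofReal (-Real.log x) *
        Φ ω (disk ρ \ disk r) + ∫⁻ p, tailTerm α T (θ * ρ ^ α) ρ p ∂(Φ ω)) -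
        expNeg (∞ * Φ ω (disk r) + ∞ * Φ ω (disk ρ \ disk r) +
        ∫⁻ p, tailTerm α T (θ * ρ ^ α) ρ p ∂(Φ ω))) - x) ∂P ≤
        ∫ ω in {ω | r < nearestDist (Φ ω) ∧ nearestDist (Φ ω) ≤ ρ},
        expNeg (thresholdGain α T θ (Φ ω)) ∂P := by
      rw [← integral_indicator hE]
      refine integral_mono_ae ((((hi _).sub (hi _)).const_mul _).sub (integrable_const _))
        ((integrable_expNeg ((measurable_thresholdGain hT θ).comp hΦ.measurable)).indicator hE) ?_
      filter_upwards [hΦ.ae_isRegular hS hT hTpos] with ω hω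
      exact hω.indicator_expNeg_ge hT hα0 hθ hr.le hrρ hx0 hx1
    have hi' : Integrable (fun ω => x⁻¹ * (expNeg (∞ * Φ ω (disk r) +
        ENNReal.ofReal (-Real.log x) * Φ ω (disk ρ \ disk r) +
        ∫⁻ p, tailTerm α T (θ * ρ ^ α) ρ p ∂(Φ ω)) -
        expNeg (∞ * Φ ω (disk r) + ∞ * Φ ω (disk ρ \ disk r) +
        ∫⁻ p, tailTerm α T (θ * ρ ^ α) ρ p ∂(Φ ω)))) P := ((hi _).sub (hi _)).const_mul _
    rw [integral_sub hi' (integrable_const _), integral_const_mul,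
      integral_sub (hi _) (hi _), hL, hL, hlog, expNeg_top, ← sub_mul, ← mul_sub] at h1
    simp only [integral_const, probReal_univ, smul_eq_mul, one_mul, sub_zero] at h1
    refine le_trans ?_ h1
    refine sub_le_sub_right ?_ x
    -- The difference quotient of the generating function at `0` dominates its derivative there, the
    -- Poisson probability of one point, by `1 + x m ≤ exp (x m)`.
    have h2 : m * Real.exp (-m) ≤ x⁻¹ * (Real.exp (-((1 - x) * m)) - Real.exp (-m)) := by
      have e : Real.exp (-((1 - x) * m)) = Real.exp (x * m) * Real.exp (-m) := by
        rw [← Real.exp_add]; congr 1; ring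
      rw [e, ← div_eq_inv_mul, le_div_iff₀ hx0]
      have := Real.add_one_le_exp (x * m)
      nlinarith [Real.exp_pos (-m)]
    calc Real.exp (-(lamS * Real.pi * r ^ 2)) * (m * Real.exp (-m)) * Real.exp (-V)
        ≤ Real.exp (-(lamS * Real.pi * r ^ 2)) *
          (x⁻¹ * (Real.exp (-((1 - x) * m)) - Real.exp (-m))) * Real.exp (-V) := by gcongr
      _ = _ := by ring
  -- The parameter `x` is arbitrarily small, so the error term disappears.
  have hlim : Real.exp (-(lamS * Real.pi * r ^ 2)) * (m * Real.exp (-m)) * Real.exp (-V) ≤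
      ∫ ω in {ω | r < nearestDist (Φ ω) ∧ nearestDist (Φ ω) ≤ ρ},
        expNeg (thresholdGain α T θ (Φ ω)) ∂P := by
    refine le_of_forall_pos_le_add fun ε hε => ?_
    have := key (min ε 1) (lt_min hε one_pos) (min_le_right _ _)
    linarith [min_le_left ε 1]
  refine le_trans ?_ hlim
  rw [measureReal_nearestDist_annulus hS hΦ hT hTpos hr.le hrρ]
  have e : Real.exp (-(lamS * Real.pi * ρ ^ 2)) =
      Real.exp (-(lamS * Real.pi * r ^ 2)) * Real.exp (-m) := by
    rw [← Real.exp_add, hm]; congr 1; ring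
  -- This bounds the single-point probability from below by the probability of a nonempty annulus
  -- times `exp (-m)`.
  have h3 : 1 - Real.exp (-m) ≤ m := by linarith [Real.add_one_le_exp (-m)]
  rw [e]
  calc _ = Real.exp (-(lamS * Real.pi * r ^ 2)) * ((1 - Real.exp (-m)) * Real.exp (-m)) *
        Real.exp (-V) := by ring
    _ ≤ _ := by gcongr

/-! ### The coverage probability -/

/-- Geometric annuli partition `(0, ∞)`, and the nearest distance is almost surely positive. Their
constant ratio makes the relative error of the annulus bounds the same at every scale. -/
lemma hasSum_setIntegral_zpow_annulus (hS : 0 < lamS)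
    (hΦ : IsPoissonProcess P Φ (sbsIntensity lamS)) (hT : MeasurableSet T)
    (hTpos : (volume : Measure ℝ).restrict (Icc 0 1) T ≠ 0) {δ : ℝ} (hδ : 1 < δ) {f : Ω → ℝ}
    (hf : Integrable f P) :
    HasSum (fun i : ℤ => ∫ ω in {ω | δ ^ i < nearestDist (Φ ω) ∧ nearestDist (Φ ω) ≤ δ * δ ^ i},
      f ω ∂P) (∫ ω, f ω ∂P) := by
  have hδ0 : 0 < δ := by linarith
  have hR : Measurable fun ω => nearestDist (Φ ω) := measurable_nearestDist.comp hΦ.measurable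
  have h := hasSum_integral_iUnion (μ := P) (f := f)
    (s := fun i : ℤ => {ω | δ ^ i < nearestDist (Φ ω) ∧ nearestDist (Φ ω) ≤ δ * δ ^ i})
    (fun i => (measurableSet_lt measurable_const hR).inter (measurableSet_le hR measurable_const))
    ?_ hf.integrableOn
  · have hu : (⋃ i : ℤ, {ω | δ ^ i < nearestDist (Φ ω) ∧ nearestDist (Φ ω) ≤ δ * δ ^ i})
        =ᵐ[P] univ := by
      rw [eventuallyEq_univ]
      filter_upwards [hΦ.ae_isRegular hS hT hTpos] with ω hω
      obtain ⟨i, hi1, hi2⟩ := exists_mem_Ioc_zpow hω.nearestDist_pos hδ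
      refine mem_iUnion.2 ⟨i, hi1, ?_⟩
      rwa [zpow_add_one₀ hδ0.ne', mul_comm] at hi2
    rwa [setIntegral_congr_set hu, setIntegral_univ] at h
  · have hlt : ∀ i j : ℤ, i < j → ∀ ω, nearestDist (Φ ω) ≤ δ * δ ^ i →
        ¬ δ ^ j < nearestDist (Φ ω) := by
      intro i j hij ω h1
      have : δ * δ ^ i ≤ δ ^ j := by
        rw [mul_comm, ← zpow_add_one₀ hδ0.ne']
        exact zpow_le_zpow_right₀ hδ.le hij
      exact not_lt.2 (h1.trans this)
    intro i j hij
    rw [Function.onFun, disjoint_left]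
    intro ω h1 h2
    rcases lt_or_gt_of_ne hij with h | h
    · exact hlt i j h ω h1.2 h2.1
    · exact hlt j i h ω h2.2 h1.1

/-- The annulus bounds place the mean between the Laplace transforms of `R ^ 2` at two parameters
that both tend to `G` as `δ` decreases to `1`. -/
lemma integral_expNeg_thresholdGain (hS : 0 < lamS)
    (hΦ : IsPoissonProcess P Φ (sbsIntensity lamS)) (hT : MeasurableSet T)
    (hTpos : (volume : Measure ℝ).restrict (Icc 0 1) T ≠ 0) {α : ℝ} (hα : 2 < α) {θ : ℝ}
    (hθ : 0 < θ) :
    ∫ ω, expNeg (thresholdGain α T θ (Φ ω)) ∂P =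
      1 / (1 + ((volume : Measure ℝ).restrict (Icc 0 1)).real T * sirFactor α θ) := by
  set a := lamS * Real.pi with ha
  have ha0 : 0 < a := by positivity
  set G := ((volume : Measure ℝ).restrict (Icc 0 1)).real T * sirFactor α θ with hG
  have hG0 : 0 < G := by
    have h1 : 0 < ((volume : Measure ℝ).restrict (Icc 0 1)).real T :=
      ENNReal.toReal_pos hTpos (measure_ne_top _ _)
    have h2 : 0 < sirFactor α θ := by
      rw [← sirFactor_zero α]
      exact sirFactor_strictMonoOn hα self_mem_Ici hθ.le hθ
    positivity
  have hR : Measurable fun ω => nearestDist (Φ ω) := measurable_nearestDist.comp hΦ.measurable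
  have hX : Integrable (fun ω => expNeg (thresholdGain α T θ (Φ ω))) P :=
    integrable_expNeg ((measurable_thresholdGain hT θ).comp hΦ.measurable)
  have hexp : ∀ b : ℝ, 0 ≤ b →
      Integrable (fun ω => Real.exp (-(a * b * nearestDist (Φ ω) ^ 2))) P := by
    intro b hb
    refine Integrable.of_bound (Measurable.aestronglyMeasurable (((hR.pow_const 2).const_mul
      (a * b)).neg.exp)) 1 (ae_of_all _ fun ω => ?_)
    rw [Real.norm_eq_abs, Real.abs_exp, Real.exp_le_one_iff, neg_nonpos]
    positivity
  have hE : ∀ r ρ : ℝ, MeasurableSet {ω | r < nearestDist (Φ ω) ∧ nearestDist (Φ ω) ≤ ρ} :=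
    fun r ρ => (measurableSet_lt measurable_const hR).inter (measurableSet_le hR measurable_const)
  -- With `ρ = δ r` the annulus factor is `exp (-a (G - (δ ^ 2 - 1)) r ^ 2)`, and `R ^ 2 ≤ δ ^ 2 r ^
  -- 2` gives the parameter shown. The condition on `δ` keeps it nonnegative; it holds near `1`
  -- because `G > 0`.
  have hup : ∀ δ : ℝ, 1 < δ → δ ^ 2 - 1 ≤ G →
      ∫ ω, expNeg (thresholdGain α T θ (Φ ω)) ∂P ≤ 1 / (1 + (G - (δ ^ 2 - 1)) / δ ^ 2) := by
    intro δ hδ hδG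
    have hδ0 : 0 < δ := by linarith
    have hb : 0 ≤ (G - (δ ^ 2 - 1)) / δ ^ 2 := div_nonneg (by linarith) (by positivity)
    rw [← integral_exp_neg_nearestDist_sq hS hΦ hT hTpos hb]
    refine hasSum_le (fun i => ?_) (hasSum_setIntegral_zpow_annulus hS hΦ hT hTpos hδ hX)
      (hasSum_setIntegral_zpow_annulus hS hΦ hT hTpos hδ (hexp _ hb))
    have hr : 0 < δ ^ i := zpow_pos hδ0 i
    set r := δ ^ i
    refine (setIntegral_expNeg_thresholdGain_le hS hΦ hT hTpos hα hθ.le hr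
      (le_mul_of_one_le_left hr.le hδ.le)).trans ?_
    rw [← smul_eq_mul, ← setIntegral_const]
    refine setIntegral_mono_on (integrable_const _).integrableOn (hexp _ hb).integrableOn (hE _ _)
      fun ω hω => ?_
    rw [← Real.exp_add, Real.exp_le_exp, ← hG, ← ha]
    have h2 : nearestDist (Φ ω) ^ 2 ≤ δ ^ 2 * r ^ 2 := by
      rw [← mul_pow]; exact pow_le_pow_left₀ (nearestDist_nonneg _) hω.2 2
    have h3 : a * ((G - (δ ^ 2 - 1)) / δ ^ 2) * nearestDist (Φ ω) ^ 2 ≤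
        a * ((G - (δ ^ 2 - 1)) / δ ^ 2) * (δ ^ 2 * r ^ 2) := by gcongr
    have h4 : a * ((G - (δ ^ 2 - 1)) / δ ^ 2) * (δ ^ 2 * r ^ 2) =
        a * (G - (δ ^ 2 - 1)) * r ^ 2 := by field_simp
    nlinarith
  -- Now the annulus factor is `exp (-a (δ ^ 2 - 1 + G δ ^ 2) r ^ 2)`, and `r < R` suffices.
  have hlow : ∀ δ : ℝ, 1 < δ →
      1 / (1 + (δ ^ 2 - 1 + G * δ ^ 2)) ≤ ∫ ω, expNeg (thresholdGain α T θ (Φ ω)) ∂P := by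
    intro δ hδ
    have hδ0 : 0 < δ := by linarith
    have hδ1 : 0 ≤ δ ^ 2 - 1 := by nlinarith
    have hb : 0 ≤ δ ^ 2 - 1 + G * δ ^ 2 := by positivity
    rw [← integral_exp_neg_nearestDist_sq hS hΦ hT hTpos hb]
    refine hasSum_le (fun i => ?_) (hasSum_setIntegral_zpow_annulus hS hΦ hT hTpos hδ (hexp _ hb))
      (hasSum_setIntegral_zpow_annulus hS hΦ hT hTpos hδ hX)
    have hr : 0 < δ ^ i := zpow_pos hδ0 i
    set r := δ ^ i
    refine le_trans ?_ (le_setIntegral_expNeg_thresholdGain hS hΦ hT hTpos hα hθ.le hr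
      (le_mul_of_one_le_left hr.le hδ.le))
    rw [← smul_eq_mul (P.real _), ← setIntegral_const]
    refine setIntegral_mono_on (hexp _ hb).integrableOn (integrable_const _).integrableOn (hE _ _)
      fun ω hω => ?_
    rw [← Real.exp_add, Real.exp_le_exp, ← hG, ← ha]
    have h2 : r ^ 2 ≤ nearestDist (Φ ω) ^ 2 := pow_le_pow_left₀ hr.le hω.1.le 2
    have h3 : a * (δ ^ 2 - 1 + G * δ ^ 2) * r ^ 2 ≤
        a * (δ ^ 2 - 1 + G * δ ^ 2) * nearestDist (Φ ω) ^ 2 := by gcongr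
    nlinarith
  refine le_antisymm ?_ ?_
  · have hc : Tendsto (fun δ : ℝ => 1 / (1 + (G - (δ ^ 2 - 1)) / δ ^ 2)) (𝓝[>] 1)
        (𝓝 (1 / (1 + (G - ((1 : ℝ) ^ 2 - 1)) / 1 ^ 2))) := by
      refine (ContinuousAt.tendsto ?_).mono_left nhdsWithin_le_nhds
      refine continuousAt_const.div (continuousAt_const.add (ContinuousAt.div (by fun_prop)
        (by fun_prop) (by simp))) (by simp; positivity)
    have hlim : Tendsto (fun δ : ℝ => δ ^ 2 - 1) (𝓝[>] 1) (𝓝 ((1 : ℝ) ^ 2 - 1)) :=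
      (Continuous.tendsto (by fun_prop) _).mono_left nhdsWithin_le_nhds
    have hev : ∀ᶠ δ : ℝ in 𝓝[>] 1, δ ^ 2 - 1 < G := hlim.eventually_lt_const (by simpa using hG0)
    have := ge_of_tendsto hc (by
      filter_upwards [hev, self_mem_nhdsWithin] with δ h1 h2 using hup δ h2 h1.le)
    simpa using this
  · have hc : Tendsto (fun δ : ℝ => 1 / (1 + (δ ^ 2 - 1 + G * δ ^ 2))) (𝓝[>] 1)
        (𝓝 (1 / (1 + ((1 : ℝ) ^ 2 - 1 + G * 1 ^ 2)))) := by
      refine (ContinuousAt.tendsto ?_).mono_left nhdsWithin_le_nhds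
      exact continuousAt_const.div (by fun_prop) (by simp; positivity)
    have := le_of_tendsto hc (by
      filter_upwards [self_mem_nhdsWithin] with δ h2 using hlow δ h2)
    simpa using this

end Network

/-! ### From rates to gain thresholds -/

lemma expMeasure_le_ofReal (x : ℝ≥0∞) :
    expMeasure 1 {h : ℝ | x ≤ ENNReal.ofReal h} = ENNReal.ofReal (expNeg x) := by
  rcases eq_or_ne x ∞ with rfl | hx
  · simp
  · have e : {h : ℝ | x ≤ ENNReal.ofReal h} =ᵐ[expMeasure 1] Ici x.toReal := by
      filter_upwards [expMeasure_ae_pos] with h hh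
      exact propext (ENNReal.le_ofReal_iff_toReal_le hx hh.le)
    rw [measure_congr e, expNeg_of_ne_top hx, ← expMeasure_real_Ici ENNReal.toReal_nonneg,
      ofReal_measureReal]

section Network

variable {Ω : Type*} [MeasurableSpace Ω] {P : Measure Ω} [IsProbabilityMeasure P] {lamS : ℝ}
  {Φ : Ω → Measure MarkedSBS} {h : Ω → ℝ} {T : Set ℝ}

/-- The serving gain is independent of the configuration and has tail `exp (-x)`, so Fubini
integrates it out. -/
lemma IsSBSNetwork.measureReal_le_gain (hnet : IsSBSNetwork P lamS Φ h)
    {X : Measure MarkedSBS → ℝ≥0∞} (hX : Measurable X) :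
    P.real {ω | X (Φ ω) ≤ ENNReal.ofReal (h ω)} = ∫ ω, expNeg (X (Φ ω)) ∂P := by
  have hXΦ : Measurable fun ω => X (Φ ω) := hX.comp hnet.poisson.measurable
  have hind : IndepFun (fun ω => X (Φ ω)) h P := (hnet.indep.comp measurable_id hX).symm
  have hmap := (indepFun_iff_map_prod_eq_prod_map_map hXΦ.aemeasurable
    hnet.h_measurable.aemeasurable).1 hind
  have hS : MeasurableSet {z : ℝ≥0∞ × ℝ | z.1 ≤ ENNReal.ofReal z.2} :=
    measurableSet_le measurable_fst measurable_snd.ennreal_ofReal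
  have h1 : P {ω | X (Φ ω) ≤ ENNReal.ofReal (h ω)} =
      ∫⁻ ω, ENNReal.ofReal (expNeg (X (Φ ω))) ∂P := by
    have h2 := Measure.map_apply (μ := P) (hXΦ.prodMk hnet.h_measurable) hS
    rw [hmap, hnet.h_law, Measure.prod_apply hS] at h2
    refine h2.symm.trans ?_
    rw [lintegral_map (measurable_measure_prodMk_left hS) hXΦ]
    exact lintegral_congr fun ω => expMeasure_le_ofReal _
  rw [measureReal_def, h1, integral_eq_lintegral_of_nonneg_ae
    (ae_of_all _ fun _ => expNeg_nonneg _) (measurable_expNeg.comp hXΦ).aestronglyMeasurable]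

/-- Solving the rate inequality for the gain; the transmit power and the path loss constant cancel.
-/
lemma le_accessRate_iff {s : SystemParams} (hs : s.Valid) (hT : MeasurableSet T)
    {N : Measure MarkedSBS} (hN : IsRegular T N) {D bw g : ℝ} (hD : 0 < D) (hbw : 0 < bw) {k : ℕ}
    (hk : 1 ≤ k) (hg : 0 < g) :
    D ≤ accessRate s bw T k N g ↔
      thresholdGain s.α T ((2 : ℝ) ^ (k * (D / bw)) - 1) N ≤ ENNReal.ofReal g := by
  have hk0 : (0 : ℝ) < k := by exact_mod_cast hk
  have hy : 0 < k * (D / bw) := by positivity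
  set y := k * (D / bw) with hydef
  have hθ : 0 < (2 : ℝ) ^ y - 1 := sub_pos.2 (Real.one_lt_rpow (by norm_num) hy)
  set θ := (2 : ℝ) ^ y - 1 with hθdef
  have hR := hN.nearestDist_pos
  set R := nearestDist N with hRdef
  have hPa := hs.Pa_pos
  have hβ := hs.β_pos
  have hRα : 0 < R ^ s.α := Real.rpow_pos_of_pos hR _
  have hSN := hN.shotNoise_ne_zero (α := s.α) hT
  rw [accessRate, interference_eq_shotNoise hPa.le hβ.le hT, thresholdGain, ← hRdef]
  -- Infinite shot noise becomes `0` under `toReal`, and the division by it gives rate `0`. Delivery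
  -- fails, in agreement with the infinite threshold.
  by_cases htop : shotNoise s.α T N = ∞
  · rw [htop, ENNReal.mul_top (by simpa using by positivity)]
    simp [hD]
  · have hv : 0 < (shotNoise s.α T N).toReal := ENNReal.toReal_pos hSN htop
    rw [← ENNReal.ofReal_toReal htop]
    set v := (shotNoise s.α T N).toReal
    rw [← ENNReal.ofReal_mul (by positivity), ENNReal.ofReal_le_ofReal_iff hg.le,
      ENNReal.toReal_ofReal hv.le, pathLoss, Real.rpow_neg hR.le]
    have e : s.Pa * g * (s.β * (R ^ s.α)⁻¹) / (s.Pa * s.β * v) = g / (R ^ s.α * v) := by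
      field_simp
    rw [e]
    have hpos : 0 < 1 + g / (R ^ s.α * v) := by positivity
    have h1 : D ≤ bw / k * Real.logb 2 (1 + g / (R ^ s.α * v)) ↔
        y ≤ Real.logb 2 (1 + g / (R ^ s.α * v)) := by
      rw [hydef, ← mul_div_assoc, div_le_iff₀ hbw, div_mul_eq_mul_div, le_div_iff₀ hk0,
        mul_comm D, mul_comm bw]
    rw [h1, Real.le_logb_iff_rpow_le (by norm_num) hpos, ← sub_le_iff_le_add', ← hθdef,
      le_div_iff₀ (by positivity), mul_assoc]

/-- The delivery probability over the access link at load `k`. -/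
lemma IsSBSNetwork.measureReal_le_accessRate (hnet : IsSBSNetwork P lamS Φ h) (hS : 0 < lamS)
    {s : SystemParams} (hs : s.Valid) (hT : MeasurableSet T)
    (hTpos : (volume : Measure ℝ).restrict (Icc 0 1) T ≠ 0) {D bw : ℝ} (hD : 0 < D)
    (hbw : 0 < bw) {k : ℕ} (hk : 1 ≤ k) :
    P.real {ω | D ≤ accessRate s bw T k (Φ ω) (h ω)} =
      1 / (1 + ((volume : Measure ℝ).restrict (Icc 0 1)).real T *
        loadFactor s.α (k * (D / bw))) := by
  have hk0 : (0 : ℝ) < k := by exact_mod_cast hk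
  have hy : 0 < k * (D / bw) := by positivity
  have hθ : 0 < (2 : ℝ) ^ (k * (D / bw)) - 1 := sub_pos.2 (Real.one_lt_rpow (by norm_num) hy)
  have hh : ∀ᵐ ω ∂P, 0 < h ω := by
    refine (ae_map_iff hnet.h_measurable.aemeasurable measurableSet_Ioi).1 ?_
    rw [hnet.h_law]
    exact expMeasure_ae_pos
  rw [loadFactor_eq_sirFactor hs.α_gt hy.le,
    ← integral_expNeg_thresholdGain hS hnet.poisson hT hTpos hs.α_gt hθ,
    ← hnet.measureReal_le_gain (measurable_thresholdGain hT _)]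
  refine measureReal_congr ?_
  filter_upwards [hh, hnet.poisson.ae_isRegular hS hT hTpos] with ω h1 h2
  exact propext (le_accessRate_iff hs hT h2 hD hbw hk h1)

end Network

/-! ### Success at level `ε` as a bound on the load -/

lemma le_one_div_one_add_mul_iff {ε q G : ℝ} (hε : 0 < ε) (hq : 0 < q) (hG : 0 ≤ G) :
    ε ≤ 1 / (1 + q * G) ↔ G ≤ (1 - ε) / (q * ε) := by
  rw [le_div_iff₀ (by positivity), le_div_iff₀ (by positivity)]
  constructor <;> intro h <;> linarith

lemma uniform_real_Iic {q : ℝ} (h0 : 0 ≤ q) (h1 : q ≤ 1) :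
    ((volume : Measure ℝ).restrict (Icc 0 1)).real (Iic q) = q := by
  have e : Iic q ∩ Icc 0 1 = Icc 0 q := by
    ext x
    simp only [mem_inter_iff, mem_Iic, mem_Icc]
    constructor <;> intro h <;> refine ⟨?_, ?_⟩ <;> grind
  rw [measureReal_restrict_apply measurableSet_Iic, e]
  simp [h0]

lemma uniform_real_Ioi {q : ℝ} (h0 : 0 ≤ q) (h1 : q ≤ 1) :
    ((volume : Measure ℝ).restrict (Icc 0 1)).real (Ioi q) = 1 - q := by
  rw [← compl_Iic, probReal_compl_eq_one_sub measurableSet_Iic, uniform_real_Iic h0 h1]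

lemma effA_pos {s : SystemParams} (hs : s.Valid) : 0 < effA s := by
  have := hs.Q_pos; have := hs.η_pos; have := hs.W_pos
  have : 0 < s.Tth := hs.T1_nonneg.trans_lt hs.T1_lt
  unfold effA
  positivity

lemma effB_pos {s : SystemParams} (hs : s.Valid) : 0 < effB s := by
  have := hs.Q_pos; have := hs.W_pos
  have : 0 < 1 - s.η := sub_pos.2 hs.η_lt
  have : 0 < s.Tth - s.T1 := sub_pos.2 hs.T1_lt
  unfold effB
  positivity

section Network

variable {Ω : Type*} [MeasurableSpace Ω] {P : Measure Ω} [IsProbabilityMeasure P] {lamS : ℝ}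
  {Φ : Ω → Measure MarkedSBS} {h : Ω → ℝ}

/-- A uniform type mark lies in `Iic q` with probability `q`, so the coverage formula reads `1 / (1
+ q G(k A))`; comparing it with `ε` gives the level in `maxLoadA`. -/
lemma IsSBSNetwork.le_successA_iff (hnet : IsSBSNetwork P lamS Φ h) (hS : 0 < lamS)
    {s : SystemParams} (hs : s.Valid) {q : ℝ} (hq0 : 0 < q) (hq1 : q < 1) {k : ℕ} (hk : 1 ≤ k) :
    s.ε ≤ successA P s Φ h q k ↔ k ≤ maxLoadA s q := by
  have hQ := hs.Q_pos
  have hη := hs.η_pos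
  have hW := hs.W_pos
  have hT : 0 < s.Tth := hs.T1_nonneg.trans_lt hs.T1_lt
  have hu := uniform_real_Iic hq0.le hq1.le
  have hTpos : (volume : Measure ℝ).restrict (Icc 0 1) (Iic q) ≠ 0 := fun h0 => by
    rw [measureReal_def, h0] at hu
    exact hq0.ne hu
  have e : s.Q / s.Tth / (s.η * s.W) = effA s := by
    rw [effA, div_div]; congr 1; ring
  rw [successA, hnet.measureReal_le_accessRate hS hs measurableSet_Iic hTpos (by positivity)
    (by positivity) hk, e, hu, le_one_div_one_add_mul_iff hs.ε_pos hq0, maxLoadA,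
    le_maxLoad_iff hs.α_gt (effA_pos hs)]
  · exact div_nonneg (sub_nonneg.2 hs.ε_lt.le) (mul_nonneg hq0.le hs.ε_pos.le)
  · have := effA_pos hs
    have hk0 : (0 : ℝ) < k := by exact_mod_cast hk
    exact (loadFactor_pos hs.α_gt (by positivity)).le

lemma IsSBSNetwork.le_successB_iff (hnet : IsSBSNetwork P lamS Φ h) (hS : 0 < lamS)
    {s : SystemParams} (hs : s.Valid) {q : ℝ} (hq0 : 0 < q) (hq1 : q < 1) {k : ℕ} (hk : 1 ≤ k) :
    s.ε ≤ successB P s Φ h q k ↔ k ≤ maxLoadB s q := by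
  have hQ := hs.Q_pos
  have hη : 0 < 1 - s.η := sub_pos.2 hs.η_lt
  have hW := hs.W_pos
  have hT : 0 < s.Tth - s.T1 := sub_pos.2 hs.T1_lt
  have hq1' : 0 < 1 - q := sub_pos.2 hq1
  have hu := uniform_real_Ioi hq0.le hq1.le
  have hTpos : (volume : Measure ℝ).restrict (Icc 0 1) (Ioi q) ≠ 0 := fun h0 => by
    rw [measureReal_def, h0] at hu
    exact hq1'.ne hu
  have e : s.Q / (s.Tth - s.T1) / ((1 - s.η) * s.W) = effB s := by
    rw [effB, div_div]; congr 1; ring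
  rw [successB, hnet.measureReal_le_accessRate hS hs measurableSet_Ioi hTpos (by positivity)
    (by positivity) hk, e, hu, le_one_div_one_add_mul_iff hs.ε_pos hq1', maxLoadB,
    le_maxLoad_iff hs.α_gt (effB_pos hs)]
  · exact div_nonneg (sub_nonneg.2 hs.ε_lt.le) (mul_nonneg hq1'.le hs.ε_pos.le)
  · have := effB_pos hs
    have hk0 : (0 : ℝ) < k := by exact_mod_cast hk
    exact (loadFactor_pos hs.α_gt (by positivity)).le

lemma scdOf_eq_loadCDF {ε x : ℝ} {succ : ℕ → ℝ} {K : ℕ}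
    (h : ∀ k, 1 ≤ k → (ε ≤ succ k ↔ k ≤ K)) : scdOf ε x succ = loadCDF x K := by
  classical
  have hiff : ∀ k, (1 ≤ k ∧ ε ≤ succ k) ↔ k ∈ Finset.Icc 1 K := fun k => by
    rw [Finset.mem_Icc]
    exact and_congr_right fun hk => h k hk
  rw [scdOf, loadCDF, tsum_eq_sum (s := Finset.Icc 1 K)
    (fun k hk => if_neg fun h' => hk ((hiff k).1 h'))]
  exact Finset.sum_congr rfl fun k hk => if_pos ((hiff k).2 hk)

/-- The SCD probability in terms of the maximum loads. -/
theorem IsSBSNetwork.scdProb_eq (hnet : IsSBSNetwork P lamS Φ h) (hS : 0 < lamS)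
    {s : SystemParams} (hs : s.Valid) (lamU : ℝ) {q : ℝ} (hq0 : 0 < q) (hq1 : q < 1) :
    scdProb P s Φ h lamU lamS q = q * loadCDF (lamU / lamS) (maxLoadA s q) +
      (1 - q) * loadCDF (lamU / lamS) (maxLoadB s q) := by
  rw [scdProb, scdOf_eq_loadCDF fun k hk => hnet.le_successA_iff hS hs hq0 hq1 hk,
    scdOf_eq_loadCDF fun k hk => hnet.le_successB_iff hS hs hq0 hq1 hk]

end Network

/-! ### The load PMF -/

lemma gam_pos : 0 < gam := by norm_num [gam]

lemma loadPMF_nonneg {x : ℝ} (hx : 0 ≤ x) (k : ℕ) : 0 ≤ loadPMF x k := by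
  have := gam_pos
  have h1 : 0 < Real.Gamma (k + gam) := Real.Gamma_pos_of_pos (by positivity)
  have h2 : 0 < Real.Gamma gam := Real.Gamma_pos_of_pos gam_pos
  unfold loadPMF
  positivity

lemma loadPMF_succ {x : ℝ} (hx : 0 ≤ x) {k : ℕ} (hk : 1 ≤ k) :
    loadPMF x (k + 1) = loadPMF x k * ((k + gam) * x / (k * (gam + x))) := by
  have hg := gam_pos
  have hk0 : (0 : ℝ) < k := by exact_mod_cast hk
  have hfac : ((k + 1 - 1).factorial : ℝ) = k * (k - 1).factorial := by
    rw [Nat.add_sub_cancel, ← Nat.mul_factorial_pred (by omega)]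
    push_cast
    rfl
  have hG : Real.Gamma (((k + 1 : ℕ) : ℝ) + gam) = (k + gam) * Real.Gamma (k + gam) := by
    rw [← Real.Gamma_add_one (by positivity)]
    congr 1
    push_cast
    ring
  have hp : x ^ (k + 1 - 1) = x ^ (k - 1) * x := by
    rw [← pow_succ]
    congr 1
    omega
  have hr : (gam + x) ^ (((k + 1 : ℕ) : ℝ) + gam) = (gam + x) ^ ((k : ℝ) + gam) * (gam + x) := by
    rw [← Real.rpow_add_one (by positivity)]
    congr 1
    push_cast
    ring
  have hD : 0 < (gam + x) ^ ((k : ℝ) + gam) := Real.rpow_pos_of_pos (by positivity) _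
  have hfp : (0 : ℝ) < (k - 1).factorial := by positivity
  have hGp : 0 < Real.Gamma gam := Real.Gamma_pos_of_pos hg
  rw [loadPMF, loadPMF, hfac, hG, hp, hr]
  generalize (gam + x) ^ ((k : ℝ) + gam) = D at *
  have : 0 < gam + x := by positivity
  field_simp

/-- The ratio of successive values is `(k + γ) x / (k (γ + x))`, which is at most `1` exactly when
`x ≤ k`. -/
lemma loadPMF_succ_le {x : ℝ} (hx : 0 ≤ x) {k : ℕ} (hk : 1 ≤ k) (hxk : x ≤ k) :
    loadPMF x (k + 1) ≤ loadPMF x k := by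
  have hg := gam_pos
  have hk0 : (0 : ℝ) < k := by exact_mod_cast hk
  rw [loadPMF_succ hx hk]
  refine mul_le_of_le_one_right (loadPMF_nonneg hx k) ?_
  rw [div_le_one (by positivity)]
  nlinarith

lemma loadPMF_le_of_le {x : ℝ} (hx : 0 ≤ x) {m k : ℕ} (hm : 1 ≤ m) (hxm : x ≤ m) (hmk : m ≤ k) :
    loadPMF x k ≤ loadPMF x m := by
  induction k, hmk using Nat.le_induction with
  | base => exact le_rfl
  | succ k hmk ih =>
    have : (m : ℝ) ≤ k := by exact_mod_cast hmk
    exact (loadPMF_succ_le hx (hm.trans hmk) (hxm.trans this)).trans ih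

/-- As a function of the density ratio `t`, the logarithmic derivative of the PMF at `K + 1` has the
sign of `K γ - t (γ + 1)`. This is the origin of the bound `K γ / (γ + 1)` on `μ`. -/
lemma loadPMF_mono_left {K : ℕ} {x μ : ℝ} (hx : 0 < x) (hxμ : x ≤ μ)
    (hμ : μ ≤ K * gam / (gam + 1)) : loadPMF x (K + 1) ≤ loadPMF μ (K + 1) := by
  have hg := gam_pos
  rw [le_div_iff₀ (by positivity)] at hμ
  have h1 : 0 < Real.Gamma (((K + 1 : ℕ) : ℝ) + gam) := Real.Gamma_pos_of_pos (by positivity)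
  have h2 : 0 < Real.Gamma gam := Real.Gamma_pos_of_pos hg
  unfold loadPMF
  refine mul_le_mul_of_nonneg_left ?_ (by positivity)
  rw [Nat.add_sub_cancel]
  set c := ((K + 1 : ℕ) : ℝ) + gam with hc
  have hmono : MonotoneOn (fun t : ℝ => K * Real.log t - c * Real.log (gam + t)) (Icc x μ) := by
    refine monotoneOn_of_hasDerivWithinAt_nonneg (f' := fun t => K * t⁻¹ - c * (1 / (gam + t)))
      (convex_Icc x μ) ?_ ?_ ?_
    · refine ContinuousOn.sub (continuousOn_const.mul (Real.continuousOn_log.mono ?_))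
        (continuousOn_const.mul (ContinuousOn.log (by fun_prop) ?_))
      · exact fun t ht => (hx.trans_le ht.1).ne'
      · exact fun t ht => by have := hx.trans_le ht.1; positivity
    · intro t ht
      rw [interior_Icc] at ht
      have ht0 : 0 < t := hx.trans ht.1
      have h3 : HasDerivAt (fun t : ℝ => gam + t) 1 t := (hasDerivAt_id t).const_add gam
      exact (((Real.hasDerivAt_log ht0.ne').const_mul (K : ℝ)).sub
        ((h3.log (by positivity)).const_mul c)).hasDerivWithinAt
    · intro t ht
      rw [interior_Icc] at ht
      have ht0 : 0 < t := hx.trans ht.1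
      have e : (K : ℝ) * t⁻¹ - c * (1 / (gam + t)) =
          (K * gam - t * (gam + 1)) / (t * (gam + t)) := by
        rw [hc]
        push_cast
        field_simp
        ring
      rw [e]
      refine div_nonneg ?_ (by positivity)
      nlinarith [ht.2]
  have hexp : ∀ t : ℝ, 0 < t → t ^ K / (gam + t) ^ c =
      Real.exp (K * Real.log t - c * Real.log (gam + t)) := by
    intro t ht
    rw [Real.exp_sub, Real.rpow_def_of_pos (by positivity), mul_comm c, mul_comm (K : ℝ),
      ← Real.rpow_def_of_pos ht, Real.rpow_natCast]
  rw [hexp x hx, hexp μ (hx.trans_le hxμ), Real.exp_le_exp]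
  exact hmono ⟨le_rfl, hxμ⟩ ⟨hxμ, le_rfl⟩ hxμ

/-- Under the minimum density requirement every overload probability is at most `ρ`. -/
lemma MeetsSBSDensity.loadPMF_le {lamU lamS ρ : ℝ} {K : ℕ} (hU : 0 < lamU) (hS : 0 < lamS)
    (h : MeetsSBSDensity lamU lamS K ρ) {k : ℕ} (hk : K + 1 ≤ k) :
    loadPMF (lamU / lamS) k ≤ ρ := by
  have hg := gam_pos
  rcases h with ⟨h1, h2⟩ | ⟨-, μ, ⟨hμ0, hμ⟩, hμρ, hlam⟩
  · have hx : lamU / lamS = (K : ℝ) + 1 := by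
      rw [h2]
      field_simp
    rw [hx]
    exact (loadPMF_le_of_le (by positivity) (by omega) (by push_cast; rfl) hk).trans h1
  · have hx0 : 0 < lamU / lamS := by positivity
    have hxμ : lamU / lamS ≤ μ := by
      rw [div_le_iff₀ hμ0] at hlam
      rw [div_le_iff₀ hS]
      linarith
    -- Since `γ / (γ + 1) < 1`, the density ratio is below `K + 1`, so the PMF already decreases
    -- from `K + 1` on.
    have hμK : μ ≤ K := hμ.trans (by
      rw [div_le_iff₀ (by positivity)]
      nlinarith [K.cast_nonneg (α := ℝ)])
    rw [← hμρ]
    refine (loadPMF_le_of_le hx0.le (by omega) ?_ hk).trans (loadPMF_mono_left hx0 hxμ hμ)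
    push_cast
    linarith

lemma loadCDF_mono {x : ℝ} (hx : 0 ≤ x) : Monotone (loadCDF x) := fun _ _ h =>
  Finset.sum_le_sum_of_subset_of_nonneg (Finset.Icc_subset_Icc_right h)
    fun k _ _ => loadPMF_nonneg hx k

lemma loadCDF_sub_le {x ρ : ℝ} {K K' : ℕ} (h : K ≤ K')
    (hρ : ∀ k, K + 1 ≤ k → loadPMF x k ≤ ρ) :
    loadCDF x K' - loadCDF x K ≤ ((K' : ℝ) - K) * ρ := by
  induction K', h using Nat.le_induction with
  | base => simp
  | succ n hn ih =>
    have h1 : loadCDF x (n + 1) = loadCDF x n + loadPMF x (n + 1) :=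
      Finset.sum_Icc_succ_top (by omega) _
    have h2 := hρ (n + 1) (by omega)
    rw [h1]
    push_cast
    linarith

/-! ### Zipf popularities -/

/-- Comparison with the integral of `t ^ (-ς)` over `[m, m + 1]`. For `m = 0` the endpoint value is
no upper bound (`0 ^ (-ς)` is `0` for `ς > 0`), so the integral itself, `1 / (1 - ς)`, takes its
place. -/
lemma zipf_term_le {ς : ℝ} (h0 : 0 ≤ ς) (h1 : ς < 1) (m : ℕ) :
    ((m : ℝ) + 1) ^ (-ς) ≤ (((m : ℝ) + 1) ^ (1 - ς) - (m : ℝ) ^ (1 - ς)) / (1 - ς) ∧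
    (((m : ℝ) + 1) ^ (1 - ς) - (m : ℝ) ^ (1 - ς)) / (1 - ς) ≤
      if m = 0 then 1 / (1 - ς) else (m : ℝ) ^ (-ς) := by
  have hs : 0 < 1 - ς := by linarith
  have hI : ∫ t in (m : ℝ)..(m + 1), t ^ (-ς) =
      (((m : ℝ) + 1) ^ (1 - ς) - (m : ℝ) ^ (1 - ς)) / (1 - ς) := by
    rw [integral_rpow (Or.inl (by linarith))]
    congr 1 <;> [congr 2; skip] <;> ring_nf
  have hii : IntervalIntegrable (fun t : ℝ => t ^ (-ς)) volume m (m + 1) :=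
    intervalIntegral.intervalIntegrable_rpow' (by linarith)
  have hm0 : (0 : ℝ) ≤ m := m.cast_nonneg
  constructor
  · rw [← hI]
    have := intervalIntegral.integral_mono_on_of_le_Ioo (a := (m : ℝ)) (b := m + 1) (by linarith)
      (intervalIntegrable_const (c := ((m : ℝ) + 1) ^ (-ς))) hii
      (fun t ht => Real.rpow_le_rpow_of_nonpos (hm0.trans_lt ht.1) ht.2.le (by linarith))
    simpa using this
  · split_ifs with hm
    · subst hm
      simp [Real.zero_rpow hs.ne']
    · have hm1 : (0 : ℝ) < m := by positivity
      rw [← hI]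
      have := intervalIntegral.integral_mono_on_of_le_Ioo (a := (m : ℝ)) (b := m + 1) (by linarith)
        hii (intervalIntegrable_const (c := (m : ℝ) ^ (-ς)))
        (fun t ht => Real.rpow_le_rpow_of_nonpos hm1 ht.1.le (by linarith))
      simpa using this

lemma zipf_sum_bounds {ς : ℝ} (h0 : 0 ≤ ς) (h1 : ς < 1) (n : ℕ) :
    ∑ m ∈ Finset.Icc 1 n, (m : ℝ) ^ (-ς) ≤ (n : ℝ) ^ (1 - ς) / (1 - ς) ∧
    (n : ℝ) ^ (1 - ς) / (1 - ς) ≤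
      ∑ m ∈ Finset.Icc 1 n, (m : ℝ) ^ (-ς) + 1 / (1 - ς) := by
  have hs : 0 < 1 - ς := by linarith
  have hup : ∀ n : ℕ, ∑ m ∈ Finset.Icc 1 n, (m : ℝ) ^ (-ς) ≤ (n : ℝ) ^ (1 - ς) / (1 - ς) := by
    intro n
    induction n with
    | zero => simp [Real.zero_rpow hs.ne']
    | succ n ih =>
      rw [Finset.sum_Icc_succ_top (by omega)]
      have := (zipf_term_le h0 h1 n).1
      rw [sub_div] at this
      push_cast
      linarith
  -- The index is shifted by one so that the induction starts from the exceptional interval `[0,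
  -- 1]`, which accounts for the additive constant.
  have hlo : ∀ n : ℕ, ((n : ℝ) + 1) ^ (1 - ς) / (1 - ς) ≤
      ∑ m ∈ Finset.Icc 1 n, (m : ℝ) ^ (-ς) + 1 / (1 - ς) := by
    intro n
    induction n with
    | zero => simp
    | succ n ih =>
      rw [Finset.sum_Icc_succ_top (by omega)]
      have := (zipf_term_le h0 h1 (n + 1)).2
      rw [sub_div, if_neg (by omega)] at this
      push_cast at this ⊢
      linarith
  refine ⟨hup n, le_trans ?_ (hlo n)⟩
  gcongr
  linarith

lemma tendsto_zipf_sum_div {ς : ℝ} (h0 : 0 ≤ ς) (h1 : ς < 1) :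
    Tendsto (fun n : ℕ => (∑ m ∈ Finset.Icc 1 n, (m : ℝ) ^ (-ς)) / (n : ℝ) ^ (1 - ς)) atTop
      (𝓝 (1 / (1 - ς))) := by
  have hs : 0 < 1 - ς := by linarith
  have hpow : Tendsto (fun n : ℕ => (n : ℝ) ^ (1 - ς)) atTop atTop :=
    (tendsto_rpow_atTop hs).comp tendsto_natCast_atTop_atTop
  have hl : Tendsto (fun n : ℕ => 1 / (1 - ς) - 1 / (1 - ς) / (n : ℝ) ^ (1 - ς)) atTop
      (𝓝 (1 / (1 - ς))) := by
    simpa using (hpow.const_div_atTop (1 / (1 - ς))).const_sub (1 / (1 - ς))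
  refine tendsto_of_tendsto_of_tendsto_of_le_of_le' hl tendsto_const_nhds ?_ ?_
  · filter_upwards [eventually_gt_atTop 0] with n hn
    have hn0 : (0 : ℝ) < (n : ℝ) ^ (1 - ς) := Real.rpow_pos_of_pos (by exact_mod_cast hn) _
    have := (zipf_sum_bounds h0 h1 n).2
    rw [le_div_iff₀ hn0, sub_mul, div_mul_cancel₀ _ hn0.ne', one_div_mul_eq_div]
    linarith
  · filter_upwards [eventually_gt_atTop 0] with n hn
    have hn0 : (0 : ℝ) < (n : ℝ) ^ (1 - ς) := Real.rpow_pos_of_pos (by exact_mod_cast hn) _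
    rw [div_le_iff₀ hn0, one_div_mul_eq_div]
    exact (zipf_sum_bounds h0 h1 n).1

lemma mpcHitProb_eq_div (ς : ℝ) (J L : ℕ) : mpcHitProb ς J L =
    (∑ m ∈ Finset.Icc 1 L, (m : ℝ) ^ (-ς)) / ∑ m ∈ Finset.Icc 1 J, (m : ℝ) ^ (-ς) := by
  rw [mpcHitProb, Finset.sum_div]
  rfl

/-- For a large library the hit probability of caching a fraction `x` of the contents tends to
`x ^ (1 - ς)`. -/
theorem tendsto_mpcHitProb {ς : ℝ} (h0 : 0 ≤ ς) (h1 : ς < 1) {x : ℝ} (hx : 0 ≤ x) :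
    Tendsto (fun n : ℕ => mpcHitProb ς n ⌊x * n⌋₊) atTop (𝓝 (x ^ (1 - ς))) := by
  have hs : 0 < 1 - ς := by linarith
  -- For `x = 0` the number of cached contents does not tend to infinity, so the asymptotics do not
  -- apply to the numerator.
  rcases hx.eq_or_lt with rfl | hx0
  · simp [mpcHitProb, Real.zero_rpow hs.ne']
  · have hS := tendsto_zipf_sum_div h0 h1
    have hfl : Tendsto (fun n : ℕ => ⌊x * n⌋₊) atTop atTop :=
      tendsto_nat_floor_atTop.comp (tendsto_natCast_atTop_atTop.const_mul_atTop hx0)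
    have hratio : Tendsto (fun n : ℕ => ((⌊x * n⌋₊ : ℝ) / n) ^ (1 - ς)) atTop
        (𝓝 (x ^ (1 - ς))) :=
      ((tendsto_nat_floor_mul_div_atTop hx).comp tendsto_natCast_atTop_atTop).rpow_const
        (Or.inr hs.le)
    -- Both partial sums are normalized by their power asymptotics; the limit constants cancel and
    -- the ratio of the powers remains.
    have h := ((hS.comp hfl).div hS (by positivity)).mul hratio
    rw [div_self (by positivity), one_mul] at h
    refine h.congr' ?_
    filter_upwards [eventually_gt_atTop 0, hfl.eventually_gt_atTop 0] with n hn hm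
    have hn0 : (0 : ℝ) < n := by exact_mod_cast hn
    have hm0 : (0 : ℝ) < (⌊x * n⌋₊ : ℝ) := by exact_mod_cast hm
    have hn1 : (0 : ℝ) < (n : ℝ) ^ (1 - ς) := Real.rpow_pos_of_pos hn0 _
    have hm1 : (0 : ℝ) < (⌊x * n⌋₊ : ℝ) ^ (1 - ς) := Real.rpow_pos_of_pos hm0 _
    rw [mpcHitProb_eq_div, Real.div_rpow hm0.le hn0.le]
    simp only [Pi.div_apply, Function.comp]
    field_simp

/-! ### Comparison of the maximum loads -/

/-- The load factor is increasing, so a smaller required efficiency and a higher admissible level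
can only raise the maximum load. -/
lemma maxLoad_le_maxLoad {α A A' c c' : ℝ} (hα : 2 < α) (hA : 0 < A) (hAA' : A ≤ A')
    (hc' : 0 ≤ c') (hc : c' ≤ c) : maxLoad α A' c' ≤ maxLoad α A c := by
  have hA' := hA.trans_le hAA'
  rw [le_maxLoad_iff hα hA (hc'.trans hc)]
  refine le_trans ?_ (((le_maxLoad_iff hα hA' hc' _).1 le_rfl).trans hc)
  refine (loadFactor_strictMonoOn hα).monotoneOn (mem_Ici.2 (by positivity))
    (mem_Ici.2 (by positivity)) (by gcongr)

lemma level_nonneg {s : SystemParams} (hs : s.Valid) {q : ℝ} (hq : 0 < q) :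
    0 ≤ (1 - s.ε) / (q * s.ε) :=
  div_nonneg (sub_nonneg.2 hs.ε_lt.le) (mul_nonneg hq.le hs.ε_pos.le)

lemma level_anti {s : SystemParams} (hs : s.Valid) {q q' : ℝ} (hq : 0 < q) (h : q ≤ q') :
    (1 - s.ε) / (q' * s.ε) ≤ (1 - s.ε) / (q * s.ε) := by
  have h1 := hs.ε_pos
  have h2 : 0 ≤ 1 - s.ε := sub_nonneg.2 hs.ε_lt.le
  gcongr

/-- Both sides compare `(1 - η) (T_th - T_1)` with `η T_th`, the time-bandwidth products of the two
kinds of delivery. -/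
lemma effA_le_effB_iff {s : SystemParams} (hs : s.Valid) :
    effA s ≤ effB s ↔ (s.Tth - s.T1) / s.Tth ≤ s.η / (1 - s.η) := by
  have hη := hs.η_pos
  have hη' : 0 < 1 - s.η := sub_pos.2 hs.η_lt
  have hW := hs.W_pos
  have hT : 0 < s.Tth := hs.T1_nonneg.trans_lt hs.T1_lt
  have hT' : 0 < s.Tth - s.T1 := sub_pos.2 hs.T1_lt
  rw [effA, effB, div_le_div_iff_of_pos_left hs.Q_pos (by positivity) (by positivity),
    div_le_div_iff₀ hT hη']
  have e1 : (1 - s.η) * s.W * (s.Tth - s.T1) = s.W * ((s.Tth - s.T1) * (1 - s.η)) := by ring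
  have e2 : s.η * s.W * s.Tth = s.W * (s.η * s.Tth) := by ring
  rw [e1, e2, mul_le_mul_iff_right₀ hW]

lemma maxLoadB_mono {s : SystemParams} (hs : s.Valid) {q q' : ℝ} (h : q ≤ q') (hq' : q' < 1) :
    maxLoadB s q ≤ maxLoadB s q' :=
  maxLoad_le_maxLoad hs.α_gt (effB_pos hs) le_rfl (level_nonneg hs (by linarith))
    (level_anti hs (sub_pos.2 hq') (by linarith))

/-- Cached delivery is favoured twice: it needs the smaller efficiency, and for `q ≤ 1 / 2` its
interferers are no denser than those of backhauled delivery. -/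
lemma maxLoadB_le_maxLoadA {s : SystemParams} (hs : s.Valid) (h : effA s ≤ effB s) {q : ℝ}
    (hq0 : 0 < q) (hq : q ≤ 1 / 2) : maxLoadB s q ≤ maxLoadA s q :=
  maxLoad_le_maxLoad hs.α_gt (effA_pos hs) h (level_nonneg hs (by linarith))
    (level_anti hs hq0 (by linarith))

lemma maxLoadA_le_maxLoadB {s : SystemParams} (hs : s.Valid) (h : effB s ≤ effA s) {q : ℝ}
    (hq : 1 / 2 ≤ q) (hq1 : q < 1) : maxLoadA s q ≤ maxLoadB s q :=
  maxLoad_le_maxLoad hs.α_gt (effB_pos hs) h (level_nonneg hs (by linarith))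
    (level_anti hs (sub_pos.2 hq1) (by linarith))

/-- Testing the load `1` against the level explains the constants `Ξ`: the hypothesis says that the
load factor at `A` is at most `(1 - ε) / (p ε)`. It is used with `p = q` and `p = 1 - q`. -/
lemma one_le_maxLoad {s : SystemParams} (hs : s.Valid) {A p : ℝ} (hA : 0 < A) (hp : 0 < p)
    (h : p ≤ (loadFactor s.α A)⁻¹ * ((1 - s.ε) / s.ε)) :
    1 ≤ maxLoad s.α A ((1 - s.ε) / (p * s.ε)) := by
  have hε := hs.ε_pos
  have hG := loadFactor_pos hs.α_gt hA
  rw [le_maxLoad_iff hs.α_gt hA (level_nonneg hs hp), Nat.cast_one, one_mul,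
    le_div_iff₀ (by positivity)]
  rw [inv_mul_eq_div, le_div_iff₀ hG, le_div_iff₀ hε] at h
  linarith

/-! ### Hit probabilities on the two ranges of cache sizes -/

lemma le_hitProb {ς L m : ℝ} {J : ℕ} (hς : ς < 1) (hJ : 1 ≤ J) (hm : 0 ≤ m)
    (h : J * m ^ (1 / (1 - ς)) ≤ L) : m ≤ hitProb ς J L := by
  have hs : 0 < 1 - ς := by linarith
  have hJ0 : (0 : ℝ) < J := by exact_mod_cast hJ
  rw [mul_comm, ← le_div_iff₀ hJ0] at h
  calc m = (m ^ (1 / (1 - ς))) ^ (1 - ς) := by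
        rw [← Real.rpow_mul hm, one_div_mul_cancel hs.ne', Real.rpow_one]
    _ ≤ _ := Real.rpow_le_rpow (Real.rpow_nonneg hm _) h hs.le

lemma hitProb_le {ς L m : ℝ} {J : ℕ} (hς : ς < 1) (hJ : 1 ≤ J) (hm : 0 ≤ m) (hL : 0 ≤ L)
    (h : L ≤ J * m ^ (1 / (1 - ς))) : hitProb ς J L ≤ m := by
  have hs : 0 < 1 - ς := by linarith
  have hJ0 : (0 : ℝ) < J := by exact_mod_cast hJ
  rw [mul_comm, ← div_le_iff₀ hJ0] at h
  calc _ ≤ (m ^ (1 / (1 - ς))) ^ (1 - ς) := Real.rpow_le_rpow (by positivity) h hs.le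
    _ = m := by rw [← Real.rpow_mul hm, one_div_mul_cancel hs.ne', Real.rpow_one]

lemma hitProb_mono {ς L L' : ℝ} {J : ℕ} (hς : ς < 1) (hL : 0 ≤ L) (h : L ≤ L') :
    hitProb ς J L ≤ hitProb ς J L' :=
  Real.rpow_le_rpow (by positivity) (by gcongr) (by linarith)

lemma hitProb_of_mem_cacheRangeB {s : SystemParams} {ς L : ℝ} {J : ℕ} (hς : ς < 1)
    (hJ : 1 ≤ J) (hL : L ∈ cacheRangeB s ς J) :
    0 < hitProb ς J L ∧ hitProb ς J L ≤ 1 / 2 ∧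
      1 - hitProb ς J L ≤ XiB s * ((1 - s.ε) / s.ε) := by
  obtain ⟨hL0, hL1, hL2⟩ := hL
  have hJ0 : (0 : ℝ) < J := by exact_mod_cast hJ
  refine ⟨Real.rpow_pos_of_pos (by positivity) _,
    hitProb_le hς hJ (by norm_num) hL0.le hL2, ?_⟩
  -- The positive part only keeps the base of the power nonnegative; the bound needed is the one by
  -- its first argument.
  have := (le_max_left _ _).trans (le_hitProb hς hJ (le_max_right _ _) hL1)
  linarith

lemma hitProb_of_mem_cacheRangeA {s : SystemParams} (hs : s.Valid) {ς L : ℝ} {J : ℕ} (hς : ς < 1)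
    (hJ : 1 ≤ J) (hL : L ∈ cacheRangeA s ς J) :
    1 / 2 ≤ hitProb ς J L ∧ hitProb ς J L < 1 ∧
      hitProb ς J L ≤ XiA s * ((1 - s.ε) / s.ε) := by
  obtain ⟨hLJ, hL1, hL2⟩ := hL
  have hJ0 : (0 : ℝ) < J := by exact_mod_cast hJ
  have hL0 : 0 ≤ L := le_trans (by positivity) hL1
  have hXi : 0 ≤ XiA s * ((1 - s.ε) / s.ε) :=
    mul_nonneg (inv_nonneg.2 (loadFactor_pos hs.α_gt (effA_pos hs)).le)
      (div_nonneg (sub_nonneg.2 hs.ε_lt.le) hs.ε_pos.le)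
  refine ⟨le_hitProb hς hJ (by norm_num) hL1, ?_, ?_⟩
  · exact Real.rpow_lt_one (by positivity) ((div_lt_one hJ0).2 hLJ) (by linarith)
  · exact (hitProb_le hς hJ (le_min hXi zero_le_one) hL0 hL2).trans (min_le_left _ _)

/-- A mixture of load distribution functions exceeds the one with the smaller maximum load by at
most the overload level times the number of additional loads. -/
lemma mixture_loadCDF_bounds {lamU lamS ρ p : ℝ} {K K' : ℕ} (hU : 0 < lamU) (hS : 0 < lamS)
    (hp : 0 ≤ p) (hK : K ≤ K') (h : MeetsSBSDensity lamU lamS K ρ) :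
    p * loadCDF (lamU / lamS) K' + (1 - p) * loadCDF (lamU / lamS) K -
      loadCDF (lamU / lamS) K ≤ p * ((K' : ℝ) - K) * ρ := by
  have h1 := loadCDF_sub_le hK fun k hk => h.loadPMF_le hU hS hk
  have h2 := mul_le_mul_of_nonneg_left h1 hp
  linarith

lemma loadCDF_le_mixture {x p : ℝ} {K K' : ℕ} (hx : 0 ≤ x) (hp : 0 ≤ p) (hK : K ≤ K') :
    loadCDF x K ≤ p * loadCDF x K' + (1 - p) * loadCDF x K := by
  have := mul_le_mul_of_nonneg_left (loadCDF_mono hx hK) hp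
  linarith

end EdgeCaching

end

open EdgeCaching

theorem corollary7 {Ω : Type*} [MeasurableSpace Ω] (P : Measure Ω) [IsProbabilityMeasure P]
    (s : EdgeCaching.SystemParams) (hs : s.Valid)
    (lamU lamS : ℝ) (hU : 0 < lamU) (hS : 0 < lamS)
    (Φ : Ω → Measure EdgeCaching.MarkedSBS) (h : Ω → ℝ)
    (hnet : EdgeCaching.IsSBSNetwork P lamS Φ h)
    (ς : ℝ) (hς0 : 0 ≤ ς) (hς1 : ς < 1) (J : ℕ) (hJ : 1 ≤ J) :
    -- the hit probability of most-popular-content caching for a large library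
    (∀ x ∈ Icc (0 : ℝ) 1,
      Tendsto (fun n : ℕ => EdgeCaching.mpcHitProb ς n ⌊x * n⌋₊) atTop (𝓝 (x ^ (1 - ς)))) ∧
    -- more resources for the cached content delivery
    ((s.Tth - s.T1) / s.Tth ≤ s.η / (1 - s.η) →
      (∀ L ∈ EdgeCaching.cacheRangeB s ς J,
        let q := EdgeCaching.hitProb ς J L
        let KA := EdgeCaching.maxLoadA s q
        let KB := EdgeCaching.maxLoadB s q
        1 ≤ KB ∧
        ∀ ρ : ℝ, 0 < ρ → EdgeCaching.MeetsSBSDensity lamU lamS KB ρ →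
          0 ≤ EdgeCaching.scdProb P s Φ h lamU lamS q - EdgeCaching.loadCDF (lamU / lamS) KB ∧
          EdgeCaching.scdProb P s Φ h lamU lamS q - EdgeCaching.loadCDF (lamU / lamS) KB
            ≤ q * ((KA : ℝ) - KB) * ρ) ∧
      MonotoneOn
        (fun L => EdgeCaching.loadCDF (lamU / lamS)
          (EdgeCaching.maxLoadB s (EdgeCaching.hitProb ς J L)))
        (EdgeCaching.cacheRangeB s ς J) ∧
      (∀ L₁ ∈ EdgeCaching.cacheRangeB s ς J, ∀ L₂ ∈ EdgeCaching.cacheRangeB s ς J, L₁ ≤ L₂ →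
        let q₁ := EdgeCaching.hitProb ς J L₁
        let q₂ := EdgeCaching.hitProb ς J L₂
        ∀ ρ : ℝ, 0 < ρ →
          EdgeCaching.MeetsSBSDensity lamU lamS (EdgeCaching.maxLoadB s q₁) ρ →
          EdgeCaching.scdProb P s Φ h lamU lamS q₁ ≤
            EdgeCaching.scdProb P s Φ h lamU lamS q₂ +
              q₁ * ((EdgeCaching.maxLoadA s q₁ : ℝ) - EdgeCaching.maxLoadB s q₁) * ρ)) ∧
    -- more resources for the self-backhauled content delivery
    (s.η / (1 - s.η) < (s.Tth - s.T1) / s.Tth →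
      ∀ L ∈ EdgeCaching.cacheRangeA s ς J,
        let q := EdgeCaching.hitProb ς J L
        let KA := EdgeCaching.maxLoadA s q
        let KB := EdgeCaching.maxLoadB s q
        1 ≤ KA ∧
        ∀ ρ : ℝ, 0 < ρ → EdgeCaching.MeetsSBSDensity lamU lamS KA ρ →
          0 ≤ EdgeCaching.scdProb P s Φ h lamU lamS q - EdgeCaching.loadCDF (lamU / lamS) KA ∧
          EdgeCaching.scdProb P s Φ h lamU lamS q - EdgeCaching.loadCDF (lamU / lamS) KA
            ≤ (1 - q) * ((KB : ℝ) - KA) * ρ) := by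
  have hx : 0 ≤ lamU / lamS := by positivity
  refine ⟨fun x hx => tendsto_mpcHitProb hς0 hς1 hx.1, fun hη => ?_, fun hη L hL => ?_⟩
  · have hAB := (effA_le_effB_iff hs).2 hη
    have hcap : ∀ L ∈ cacheRangeB s ς J, ∀ ρ : ℝ,
        MeetsSBSDensity lamU lamS (maxLoadB s (hitProb ς J L)) ρ →
        scdProb P s Φ h lamU lamS (hitProb ς J L) -
          loadCDF (lamU / lamS) (maxLoadB s (hitProb ς J L)) ≤ hitProb ς J L *
          ((maxLoadA s (hitProb ς J L) : ℝ) - maxLoadB s (hitProb ς J L)) * ρ := by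
      intro L hL ρ hρ
      obtain ⟨hq0, hq, -⟩ := hitProb_of_mem_cacheRangeB hς1 hJ hL
      rw [hnet.scdProb_eq hS hs lamU hq0 (by linarith)]
      exact mixture_loadCDF_bounds hU hS hq0.le (maxLoadB_le_maxLoadA hs hAB hq0 hq) hρ
    have hlow : ∀ L ∈ cacheRangeB s ς J,
        loadCDF (lamU / lamS) (maxLoadB s (hitProb ς J L)) ≤
        scdProb P s Φ h lamU lamS (hitProb ς J L) := by
      intro L hL
      obtain ⟨hq0, hq, -⟩ := hitProb_of_mem_cacheRangeB hς1 hJ hL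
      rw [hnet.scdProb_eq hS hs lamU hq0 (by linarith)]
      exact loadCDF_le_mixture hx hq0.le (maxLoadB_le_maxLoadA hs hAB hq0 hq)
    have hmono : MonotoneOn
        (fun L => loadCDF (lamU / lamS) (maxLoadB s (hitProb ς J L))) (cacheRangeB s ς J) := by
      intro L₁ h₁ L₂ h₂ h₁₂
      have hq := (hitProb_of_mem_cacheRangeB hς1 hJ h₂).2.1
      exact loadCDF_mono hx (maxLoadB_mono hs (hitProb_mono hς1 h₁.1.le h₁₂) (by linarith))
    refine ⟨fun L hL => ⟨?_, fun ρ _ hρ => ⟨sub_nonneg.2 (hlow L hL), hcap L hL ρ hρ⟩⟩, hmono,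
      fun L₁ h₁ L₂ h₂ h₁₂ => ?_⟩
    · obtain ⟨hq0, hq, hqB⟩ := hitProb_of_mem_cacheRangeB hς1 hJ hL
      exact one_le_maxLoad hs (effB_pos hs) (by linarith) hqB
    · intro q₁ q₂ ρ _ hρ
      -- The comparison passes through the two distribution function values. The upper bound is used
      -- only at `L₁` and the lower bound at `L₂` is unconditional, so the density requirement is
      -- needed only at `L₁`.
      have e1 := hcap L₁ h₁ ρ hρ
      have e2 := hlow L₂ h₂
      have e3 := hmono h₁ h₂ h₁₂
      simp only at e3
      linarith
  · have hBA : effB s ≤ effA s := by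
      rw [← not_le, ← effA_le_effB_iff hs, not_le] at hη
      exact hη.le
    obtain ⟨hq, hq1, hqA⟩ := hitProb_of_mem_cacheRangeA hs hς1 hJ hL
    have hq0 : 0 < hitProb ς J L := by linarith
    have hKK := maxLoadA_le_maxLoadB hs hBA hq hq1
    refine ⟨one_le_maxLoad hs (effA_pos hs) hq0 hqA, fun ρ _ hρ => ?_⟩
    -- The larger maximum load now belongs to backhauled delivery, so the mixture is rewritten with
    -- weight `1 - q` on it to fit the same bounds.
    have e : scdProb P s Φ h lamU lamS (hitProb ς J L) =
        (1 - hitProb ς J L) * loadCDF (lamU / lamS) (maxLoadB s (hitProb ς J L)) +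
          (1 - (1 - hitProb ς J L)) * loadCDF (lamU / lamS) (maxLoadA s (hitProb ς J L)) := by
      rw [hnet.scdProb_eq hS hs lamU hq0 hq1]
      ring
    rw [e]
    exact ⟨sub_nonneg.2 (loadCDF_le_mixture hx (by linarith) hKK),
      mixture_loadCDF_bounds hU hS (by linarith) hKK hρ⟩
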